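/- Let $k\ge 1$ be an integer, $n=2k-1$, $\mu>0$ and $\psi\in(0,\pi/2)$. For $f\in C_c^\infty(\mathbb{R}^{n}\times\mathbb{R})$ let $$C_\mu f(u,v)=\int_0^\infty\int_{S^{n-1}} f\big(u+r\sin\psi\,\omega,\;v+r\cos\psi\big)\,e^{-\mu r}\,(r\sin\psi)^{n-1}\,dS(\omega)\,dr ,\qquad (u,v)\in\mathbb{R}^n\times\mathbb{R},$$ be the attenuated conical Radon transform of $f$, where $dS$ is the surface measure on the unit sphere $S^{n-1}\subset\mathbb{R}^n$ (counting measure on $\{\pm1\}$ if $n=1$), and let $$L=\frac{\mu^2}{\cos^2\psi}-\frac{2\mu}{\cos\psi}\,\partial_z+\partial_z^2-\tan^2\psi\,\Delta_x ,$$ acting on functions of $(x,z)\in\mathbb{R}^n\times\mathbb{R}$. All functions are real-valued, or all are complex-valued; the result holds in both cases. **Theorem.** A function $g\in C^\infty(\mathbb{R}^{n}\times\mathbb{R})$ is of the form $g=C_\mu f$ for some $f\in C_c^\infty(\mathbb{R}^{n}\times\mathbb{R})$ if and only if $g$ is tempered (i.e. the distribution $\varphi\mapsto\int\varphi g$, $\varphi\in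 C_c^\infty(\mathbb{R}^{n}\times\mathbb{R})$, extends to a tempered distribution; for instance, every bounded $g$ is tempered) and the following two conditions hold: (i) $L^k g$ has compact support; (ii) $\displaystyle\int_{-\infty}^{\infty} e^{-\mu z/\cos\psi}\,L^k g(x,z)\,dz=0$ for every $x\in\mathbb{R}^{n}$. In particular, for tempered (for example, bounded) $g\in C^\infty(\mathbb{R}^{n}\times\mathbb{R})$, $g$ is in the range of $C_\mu$ on $C_c^\infty(\mathbb{R}^{n}\times\mathbb{R})$ if and only if (i) and (ii) hold. -/

import Mathlib

open MeasureTheory Set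
open scoped ContDiff SchwartzMap

namespace AttenuatedCone

/-- The space `ℝⁿ × ℝ` of pairs `(x, z)`. -/
abbrev Space (n : ℕ) : Type := EuclideanSpace ℝ (Fin n) × ℝ

/-- The attenuated conical Radon transform with attenuation `μ` and half opening angle `ψ`:
`C_μ f (u, v) = ∫₀^∞ ∫_{S^{n-1}} f (u + r sin ψ θ, v + r cos ψ) e^{-μ r} (r sin ψ)^{n-1} dS(θ) dr`,
where `dS` is the surface measure of the unit sphere of `ℝⁿ` (counting measure if `n = 1`). -/
noncomputable def conicalRadon {𝕜 : Type*} [RCLike 𝕜] {n : ℕ} (μ ψ : ℝ)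
    (f : Space n → 𝕜) : Space n → 𝕜 := fun p =>
  ∫ r in Ioi (0 : ℝ),
    ∫ θ : Metric.sphere (0 : EuclideanSpace ℝ (Fin n)) 1,
      (Real.exp (-μ * r) * (r * Real.sin ψ) ^ (n - 1)) •
        f (p.1 + (r * Real.sin ψ) • (θ : EuclideanSpace ℝ (Fin n)), p.2 + r * Real.cos ψ)
      ∂(volume : Measure (EuclideanSpace ℝ (Fin n))).toSphere

/-- The partial derivative `∂_z`. -/
noncomputable def partialZ {𝕜 : Type*} [RCLike 𝕜] {n : ℕ} (g : Space n → 𝕜) : Space n → 𝕜 :=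
  fun p => deriv (fun s : ℝ => g (p.1, s)) p.2

/-- The Laplacian `Δ_x` in the variable `x ∈ ℝⁿ`. -/
noncomputable def laplacianX {𝕜 : Type*} [RCLike 𝕜] {n : ℕ} (g : Space n → 𝕜) : Space n → 𝕜 :=
  fun p => Laplacian.laplacian (fun y : EuclideanSpace ℝ (Fin n) => g (y, p.2)) p.1

/-- The operator `L = μ² / cos² ψ - (2 μ / cos ψ) ∂_z + ∂_z² - tan² ψ Δ_x`. -/
noncomputable def opL {𝕜 : Type*} [RCLike 𝕜] {n : ℕ} (μ ψ : ℝ)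
    (g : Space n → 𝕜) : Space n → 𝕜 := fun p =>
  (μ ^ 2 / Real.cos ψ ^ 2) • g p - (2 * μ / Real.cos ψ) • partialZ g p
    + partialZ (partialZ g) p - (Real.tan ψ ^ 2) • laplacianX g p

/-- A (smooth) function `g` on `ℝⁿ × ℝ` is tempered: the distribution `φ ↦ ∫ φ g` on compactly
supported smooth functions extends to a continuous linear functional on the Schwartz space. -/
def IsTempered {𝕜 : Type*} [RCLike 𝕜] {n : ℕ} (g : Space n → 𝕜) : Prop :=
  ∃ T : 𝓢(Space n, 𝕜) →L[𝕜] 𝕜,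
    ∀ φ : 𝓢(Space n, 𝕜), HasCompactSupport φ → T φ = ∫ p, φ p * g p

end AttenuatedCone

/-! Parametrising the cone by x ∈ ℝⁿ, C_μ f (u, v) is the integral of sin^{n-1}ψ · e^{-μ‖x‖} f(u +
sin ψ x, v + cos ψ ‖x‖). Thus C_μ is a Fourier multiplier. At the frequency (ξ, ζ) its symbol is
sin^{n-1}ψ times the Fourier integral of e^{-p‖x‖} at sin ψ ξ, with the complex parameter p = μ -
2πi cos ψ ζ. That integral is the Poisson kernel C p / (p² + 4π²‖ξ‖²)^{(n+1)/2}, and since n = 2k -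
1 the exponent is the integer k (`expNormFourier_eq`). With α = μ / cos ψ and σ the symbol of L
(`coneSymbol`), the multiplier is a constant times (α - 2πiζ) / σ^k, so L^k C_μ f = c (α - ∂_z) f
with c ≠ 0 (`exists_schwartz_conicalRadon`).

Necessity: the right side has compact support, and e^{-αz} (α - ∂_z) f = -∂_z (e^{-αz} f) has
integral zero in z.

Sufficiency: under (i) and (ii) the equation c (α - ∂_z) f = L^k g has a smooth compactly supported
solution (`exists_hasCompactSupport_solution`). Then g - C_μ f is tempered and killed by L^k. As α ≠
0, σ has no zeros and 1/σ has temperate growth, so L and its adjoint (μ replaced by -μ) are onto the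
Schwartz space. This forces g = C_μ f (`eq_zero_of_isTempered`). -/

namespace AttenuatedCone

/-! ### The Fourier integral of e^{-p‖x‖} in odd dimension. -/

section

lemma image_sub_div_Ioi {c : ℝ} (hc : 0 < c) :
    (fun w : ℝ => w - c / (2 * w)) '' Ioi 0 = univ := by
  refine eq_univ_of_forall fun y => ?_
  have h1 : |y| < √(y ^ 2 + 2 * c) := by
    rw [← Real.sqrt_sq_eq_abs]
    exact Real.sqrt_lt_sqrt (sq_nonneg _) (by linarith)
  -- The preimage of y is the positive root of w² - y w - c/2 = 0.
  have h2 : 0 < y + √(y ^ 2 + 2 * c) := by linarith [neg_abs_le y]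
  refine ⟨(y + √(y ^ 2 + 2 * c)) / 2, by simpa using h2, ?_⟩
  have h3 := Real.sq_sqrt (show 0 ≤ y ^ 2 + 2 * c by positivity)
  field_simp
  nlinarith

lemma injOn_sub_div_Ioi {c : ℝ} (hc : 0 < c) :
    InjOn (fun w : ℝ => w - c / (2 * w)) (Ioi 0) := by
  refine StrictMonoOn.injOn fun x hx y hy hxy => ?_
  have : c / (2 * y) < c / (2 * x) := by
    have := mem_Ioi.1 hx
    gcongr
  linarith

lemma hasDerivAt_div_two_mul (c : ℝ) {w : ℝ} (hw : w ≠ 0) :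
    HasDerivAt (fun w : ℝ => c / (2 * w)) (-(c / (2 * w ^ 2))) w := by
  have h := ((hasDerivAt_inv hw).const_mul (c / 2))
  refine (h.congr_deriv ?_).congr_of_eventuallyEq ?_
  · field_simp
  · filter_upwards with x
    ring

/-- The Cauchy–Schlömilch substitution for the Gaussian. -/
lemma integral_exp_neg_sub_div_sq {c : ℝ} (hc : 0 < c) :
    IntegrableOn (fun w : ℝ => Real.exp (-(w - c / (2 * w)) ^ 2)) (Ioi 0) ∧
    ∫ w in Ioi (0 : ℝ), Real.exp (-(w - c / (2 * w)) ^ 2) = √Real.pi / 2 := by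
  have hd : ∀ w ∈ Ioi (0 : ℝ), HasDerivWithinAt (fun w : ℝ => w - c / (2 * w))
      (1 + c / (2 * w ^ 2)) (Ioi 0) w := fun w hw => by
    have := (hasDerivAt_id' w).fun_sub (hasDerivAt_div_two_mul c (ne_of_gt hw))
    simpa using this.hasDerivWithinAt
  have hpos : ∀ w : ℝ, 0 ≤ c / (2 * w ^ 2) := fun w => by positivity
  have hG : Integrable (fun y : ℝ => Real.exp (-y ^ 2)) := by
    simpa using integrable_exp_neg_mul_sq (b := 1) one_pos
  have hI : IntegrableOn (fun w : ℝ => (1 + c / (2 * w ^ 2)) *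
      Real.exp (-(w - c / (2 * w)) ^ 2)) (Ioi 0) := by
    have := (integrableOn_image_iff_integrableOn_abs_deriv_smul measurableSet_Ioi hd
      (injOn_sub_div_Ioi hc) (fun y : ℝ => Real.exp (-y ^ 2))).1
      (by rw [image_sub_div_Ioi hc]; exact hG.integrableOn)
    refine this.congr_fun (fun w _ => ?_) measurableSet_Ioi
    simp only [smul_eq_mul]
    rw [abs_of_nonneg (by linarith [hpos w])]
  -- The substitution y = w - c/(2w) maps (0, ∞) onto ℝ with Jacobian 1 + c/(2w²), so this is the
  -- full Gaussian integral.
  have hV : ∫ w in Ioi (0 : ℝ), (1 + c / (2 * w ^ 2)) *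
      Real.exp (-(w - c / (2 * w)) ^ 2) = √Real.pi := by
    have := integral_image_eq_integral_abs_deriv_smul measurableSet_Ioi hd
      (injOn_sub_div_Ioi hc) (fun y : ℝ => Real.exp (-y ^ 2))
    rw [image_sub_div_Ioi hc, Measure.restrict_univ] at this
    have h2 := integral_gaussian 1
    simp only [neg_mul, one_mul, div_one] at h2
    rw [← h2, this]
    refine setIntegral_congr_fun measurableSet_Ioi fun w _ => ?_
    simp only [smul_eq_mul]
    rw [abs_of_nonneg (by linarith [hpos w])]
  have hmeas : Measurable fun w : ℝ => Real.exp (-(w - c / (2 * w)) ^ 2) := by fun_prop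
  have hI1 : IntegrableOn (fun w : ℝ => Real.exp (-(w - c / (2 * w)) ^ 2)) (Ioi 0) := by
    refine hI.mono' hmeas.aestronglyMeasurable ?_
    filter_upwards with w
    rw [Real.norm_eq_abs, abs_of_pos (Real.exp_pos _)]
    exact le_mul_of_one_le_left (Real.exp_pos _).le (by linarith [hpos w])
  have hI2 : IntegrableOn (fun w : ℝ => c / (2 * w ^ 2) *
      Real.exp (-(w - c / (2 * w)) ^ 2)) (Ioi 0) := by
    refine (hI.sub hI1).congr ?_
    filter_upwards with w
    simp only [Pi.sub_apply]
    ring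
  have hinv : (fun w : ℝ => c / (2 * w)) '' Ioi 0 = Ioi 0 := by
    ext y
    constructor
    · rintro ⟨w, hw, rfl⟩
      have : 0 < w := hw
      exact mem_Ioi.2 (by positivity)
    · intro hy
      have : 0 < y := hy
      exact ⟨c / (2 * y), mem_Ioi.2 (by positivity), by field_simp⟩
  have hinj : InjOn (fun w : ℝ => c / (2 * w)) (Ioi 0) := by
    intro x hx y hy hxy
    have h1 : 0 < x := hx
    have h2 : 0 < y := hy
    simp only at hxy
    field_simp at hxy
    linarith
  -- The involution w ↦ c/(2w) only changes the sign of w - c/(2w), so the two terms of the Jacobian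
  -- contribute equally and each gives half.
  have hsymm : ∫ w in Ioi (0 : ℝ), Real.exp (-(w - c / (2 * w)) ^ 2) =
      ∫ w in Ioi (0 : ℝ), c / (2 * w ^ 2) * Real.exp (-(w - c / (2 * w)) ^ 2) := by
    have := integral_image_eq_integral_abs_deriv_smul measurableSet_Ioi
      (fun w hw => (hasDerivAt_div_two_mul c (ne_of_gt (mem_Ioi.1 hw))).hasDerivWithinAt) hinj
      (fun w : ℝ => Real.exp (-(w - c / (2 * w)) ^ 2))
    rw [hinv] at this
    rw [this]
    refine setIntegral_congr_fun measurableSet_Ioi fun w hw => ?_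
    have hw : 0 < w := hw
    simp only [smul_eq_mul]
    rw [abs_neg, abs_of_nonneg (hpos w)]
    congr 3
    field_simp
    ring
  refine ⟨hI1, ?_⟩
  have hsum : ∫ w in Ioi (0 : ℝ), (1 + c / (2 * w ^ 2)) *
      Real.exp (-(w - c / (2 * w)) ^ 2) = (∫ w in Ioi (0 : ℝ),
        Real.exp (-(w - c / (2 * w)) ^ 2)) + ∫ w in Ioi (0 : ℝ), c / (2 * w ^ 2) *
      Real.exp (-(w - c / (2 * w)) ^ 2) := by
    rw [← integral_add hI1 hI2]
    congr 1
    ext w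
    ring
  rw [hV, ← hsymm] at hsum
  linarith

/-- Subordination of the exponential to the Gaussian. -/
lemma integral_exp_neg_sq_sub_div_sq {c : ℝ} (hc : 0 ≤ c) :
    ∫ w in Ioi (0 : ℝ), Real.exp (-w ^ 2 - c ^ 2 / (4 * w ^ 2)) =
      √Real.pi / 2 * Real.exp (-c) := by
  rcases hc.eq_or_lt with rfl | hc
  · have h2 := integral_gaussian_Ioi 1
    simpa using h2
  -- Completing the square: -w² - c²/(4w²) = -(w - c/(2w))² - c.
  · rw [← (integral_exp_neg_sub_div_sq hc).2, mul_comm, ← integral_const_mul]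
    refine setIntegral_congr_fun measurableSet_Ioi fun w hw => ?_
    have hw : 0 < w := hw
    rw [← Real.exp_add]
    congr 1
    field_simp
    ring

variable {E : Type*} [NormedAddCommGroup E] [InnerProductSpace ℝ E] [FiniteDimensional ℝ E]
  [MeasurableSpace E] [BorelSpace E]

lemma integrable_norm_pow_mul_exp_neg_mul_norm [Nontrivial E] (j : ℕ) {ε : ℝ} (hε : 0 < ε) :
    Integrable (fun x : E => ‖x‖ ^ j * Real.exp (-ε * ‖x‖)) := by
  rw [integrable_fun_norm_addHaar (volume : Measure E)
    (f := fun r : ℝ => r ^ j * Real.exp (-ε * r))]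
  have := integrableOn_rpow_mul_exp_neg_mul_rpow (p := 1) (b := ε)
    (s := ((Module.finrank ℝ E - 1 + j : ℕ) : ℝ))
    (lt_of_lt_of_le (by norm_num) (Nat.cast_nonneg _)) one_pos hε
  refine this.congr_fun (fun r hr => ?_) measurableSet_Ioi
  simp only [Real.rpow_natCast, Real.rpow_one, smul_eq_mul, pow_add]
  ring

/-- The Fourier integral of `x ↦ e^{-p ‖x‖}`. -/
noncomputable def expNormFourier (p : ℂ) (ξ : E) : ℂ :=
  ∫ x : E, Complex.exp (-p * ‖x‖ + 2 * Real.pi * Complex.I * (inner ℝ ξ x : ℝ))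

lemma norm_exp_neg_mul_norm_add {E : Type*} [NormedAddCommGroup E] [InnerProductSpace ℝ E]
    (p : ℂ) (ξ x : E) :
    ‖Complex.exp (-p * ‖x‖ + 2 * Real.pi * Complex.I * (inner ℝ ξ x : ℝ))‖ =
      Real.exp (-p.re * ‖x‖) := by
  rw [Complex.norm_exp]
  congr 1
  simp

lemma differentiableOn_expNormFourier [Nontrivial E] (ξ : E) :
    DifferentiableOn ℂ (fun p => expNormFourier p ξ) {p : ℂ | 0 < p.re} := by
  intro p hp
  have hp : 0 < p.re := hp
  have h := hasDerivAt_integral_of_dominated_loc_of_deriv_le (μ := (volume : Measure E))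
    (F := fun (p : ℂ) (x : E) =>
      Complex.exp (-p * ‖x‖ + 2 * Real.pi * Complex.I * (inner ℝ ξ x : ℝ)))
    (F' := fun (p : ℂ) (x : E) =>
      Complex.exp (-p * ‖x‖ + 2 * Real.pi * Complex.I * (inner ℝ ξ x : ℝ)) * (-‖x‖ : ℂ))
    (x₀ := p) (s := {q : ℂ | p.re / 2 < q.re})
    (bound := fun x => ‖x‖ ^ 1 * Real.exp (-(p.re / 2) * ‖x‖))
    ((isOpen_lt continuous_const Complex.continuous_re).mem_nhds (by simp; linarith))
    (Filter.Eventually.of_forall fun q => by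
      exact (by fun_prop : Continuous _).aestronglyMeasurable)
    ?_ (by exact (by fun_prop : Continuous _).aestronglyMeasurable) ?_
    (integrable_norm_pow_mul_exp_neg_mul_norm 1 (by linarith)) ?_
  · exact h.2.differentiableAt.differentiableWithinAt
  · refine (integrable_norm_pow_mul_exp_neg_mul_norm (E := E) 0 hp).mono'
      (by exact (by fun_prop : Continuous _).aestronglyMeasurable) ?_
    filter_upwards with x
    rw [norm_exp_neg_mul_norm_add]
    simp
  · filter_upwards with x q hq
    have hq : p.re / 2 < q.re := hq
    rw [norm_mul, norm_exp_neg_mul_norm_add]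
    simp only [norm_neg, Complex.norm_real, norm_norm, pow_one]
    rw [mul_comm]
    gcongr
  · filter_upwards with x q hq
    have h1 : HasDerivAt (fun q : ℂ => -q * ‖x‖ + 2 * Real.pi * Complex.I * (inner ℝ ξ x : ℝ))
        (-‖x‖ : ℂ) q := by
      have := (((hasDerivAt_id q).neg).mul_const (‖x‖ : ℂ)).add_const
        (2 * Real.pi * Complex.I * (inner ℝ ξ x : ℝ))
      simpa using this
    exact h1.cexp

lemma integral_gaussian_mul_exp_inner {b : ℝ} (hb : 0 < b) (ξ : E) :
    ∫ x : E, Complex.exp (-(b : ℂ) * (‖x‖ : ℂ) ^ 2 +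
        2 * Real.pi * Complex.I * (inner ℝ ξ x : ℝ)) =
      ((√(Real.pi / b) ^ Module.finrank ℝ E * Real.exp (-(Real.pi ^ 2 * ‖ξ‖ ^ 2 / b)) : ℝ) : ℂ) := by
  have := GaussianFourier.integral_cexp_neg_mul_sq_norm_add (b := (b : ℂ)) (by simpa using hb)
    (2 * Real.pi * Complex.I) ξ
  rw [this]
  push_cast
  congr 1
  · have h0 : 0 ≤ Real.pi / b := by positivity
    rw [← Complex.ofReal_div, ← Complex.ofReal_natCast, ← Complex.ofReal_ofNat,
      ← Complex.ofReal_div, ← Complex.ofReal_cpow h0, ← Complex.ofReal_pow, Real.sqrt_eq_rpow,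
      ← Real.rpow_natCast, ← Real.rpow_mul h0]
    congr 2
    ring
  · congr 1
    have hb' : (b : ℂ) ≠ 0 := by exact_mod_cast hb.ne'
    field_simp
    simp only [Complex.I_sq]
    ring

lemma integral_pow_mul_exp_neg_mul_sq {k : ℕ} (hk : 1 ≤ k) {b : ℝ} (hb : 0 < b) :
    ∫ w in Ioi (0 : ℝ), w ^ (2 * k - 1) * Real.exp (-b * w ^ 2) =
      Real.Gamma k / 2 / b ^ k := by
  have h := integral_rpow_mul_exp_neg_mul_rpow (p := 2) (q := ((2 * k - 1 : ℕ) : ℝ)) (b := b)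
    two_pos (lt_of_lt_of_le (by norm_num) (Nat.cast_nonneg _)) hb
  have h1 : (((2 * k - 1 : ℕ) : ℝ) + 1) / 2 = k := by
    rw [Nat.cast_sub (by omega)]
    push_cast
    ring
  rw [neg_div, h1] at h
  simp only [Real.rpow_natCast, Real.rpow_two] at h
  rw [h, Real.rpow_neg hb.le, Real.rpow_natCast]
  field_simp

/-- Subordination writes e^{-p‖x‖} as a superposition over w of Gaussians in x. By Fubini the
Gaussian Fourier transform is taken first; it leaves the integral of w^{2k-1} e^{-bw²} with b = 1 +
4π²‖ξ‖²/p², which is Γ(k) / (2 b^k). -/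
lemma expNormFourier_ofReal [Nontrivial E] {k : ℕ} (hk : 1 ≤ k)
    (hn : Module.finrank ℝ E = 2 * k - 1) {p : ℝ} (hp : 0 < p) (ξ : E) :
    expNormFourier (p : ℂ) ξ = ((Real.Gamma k / √Real.pi * √(4 * Real.pi) ^ (2 * k - 1) : ℝ) : ℂ) *
      p / (p ^ 2 + 4 * Real.pi ^ 2 * ‖ξ‖ ^ 2) ^ k := by
  set G : E → ℝ → ℂ := fun x w => ((Real.exp (-w ^ 2) : ℝ) : ℂ) *
    Complex.exp (-((p ^ 2 / (4 * w ^ 2) : ℝ) : ℂ) * (‖x‖ : ℂ) ^ 2 +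
        2 * Real.pi * Complex.I * (inner ℝ ξ x : ℝ)) with hG
  have hnorm : ∀ x w, ‖G x w‖ = Real.exp (-w ^ 2) * Real.exp (-(p ^ 2 / (4 * w ^ 2)) * ‖x‖ ^ 2) := by
    intro x w
    rw [hG]
    simp only [norm_mul, Complex.norm_real, Complex.norm_exp, Real.norm_eq_abs, Real.abs_exp]
    congr 2
    rw [← Complex.ofReal_pow]
    simp only [Complex.add_re, Complex.mul_re, Complex.neg_re, Complex.ofReal_re,
      Complex.neg_im, Complex.ofReal_im, Complex.re_ofNat, Complex.im_ofNat, Complex.I_re,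
      Complex.I_im, Complex.mul_im]
    ring
  have hb : ∀ w ∈ Ioi (0 : ℝ), 0 < p ^ 2 / (4 * w ^ 2) := fun w hw => by
    have : 0 < w := hw
    positivity
  have hsq : ∀ w ∈ Ioi (0 : ℝ), √(Real.pi / (p ^ 2 / (4 * w ^ 2))) = √(4 * Real.pi) / p * w := by
    intro w hw
    have : 0 < w := hw
    rw [show Real.pi / (p ^ 2 / (4 * w ^ 2)) = (4 * Real.pi) * (w / p) ^ 2 by field_simp,
      Real.sqrt_mul (by positivity), Real.sqrt_sq (by positivity)]
    ring
  have hx : ∀ x : E, ∫ w in Ioi (0 : ℝ), G x w = ((√Real.pi / 2 : ℝ) : ℂ) *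
      Complex.exp (-(p : ℂ) * ‖x‖ + 2 * Real.pi * Complex.I * (inner ℝ ξ x : ℝ)) := by
    intro x
    have h1 := integral_exp_neg_sq_sub_div_sq (c := p * ‖x‖) (by positivity)
    have h2 : ∀ w : ℝ, G x w = ((Real.exp (-w ^ 2 - (p * ‖x‖) ^ 2 / (4 * w ^ 2)) : ℝ) : ℂ) *
        Complex.exp (2 * Real.pi * Complex.I * (inner ℝ ξ x : ℝ)) := by
      intro w
      rw [hG]
      simp only
      rw [Complex.exp_add, ← mul_assoc, sub_eq_add_neg, Real.exp_add]
      push_cast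
      congr 3
      ring
    simp_rw [h2]
    rw [integral_mul_const, integral_complex_ofReal, h1, Complex.exp_add]
    push_cast
    rw [neg_mul]
    ring
  have hw : ∀ w ∈ Ioi (0 : ℝ), ∫ x : E, G x w = (((√(4 * Real.pi) / p) ^ (2 * k - 1) *
      (w ^ (2 * k - 1) * Real.exp (-(1 + 4 * Real.pi ^ 2 * ‖ξ‖ ^ 2 / p ^ 2) * w ^ 2)) : ℝ) : ℂ) := by
    intro w hw
    rw [hG]
    simp only
    rw [integral_const_mul, integral_gaussian_mul_exp_inner (hb w hw), hsq w hw, hn,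
      ← Complex.ofReal_mul]
    have hw : 0 < w := hw
    rw [mul_pow, mul_left_comm, ← Real.exp_add, mul_assoc]
    congr 5
    field_simp
    ring
  have hint : Integrable (Function.uncurry G) (volume.prod (volume.restrict (Ioi (0 : ℝ)))) := by
    have hmeas : Measurable (Function.uncurry G) := by
      simp only [hG, Function.uncurry_def]
      fun_prop
    rw [integrable_prod_iff' hmeas.aestronglyMeasurable]
    have hgint : ∀ w ∈ Ioi (0 : ℝ), Integrable (fun x : E =>
        Real.exp (-(p ^ 2 / (4 * w ^ 2)) * ‖x‖ ^ 2)) := by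
      intro w hw
      have := (GaussianFourier.integrable_cexp_neg_mul_sq_norm_add (V := E)
        (b := ((p ^ 2 / (4 * w ^ 2) : ℝ) : ℂ)) (by rw [Complex.ofReal_re]; exact hb w hw)
        0 0).norm
      refine this.congr ?_
      filter_upwards with x
      rw [Complex.norm_exp, ← Complex.ofReal_pow]
      congr 1
      simp only [Complex.add_re, Complex.mul_re, Complex.neg_re, Complex.ofReal_re,
        Complex.neg_im, Complex.ofReal_im, Complex.zero_re, Complex.zero_im]
      ring
    constructor
    · filter_upwards [ae_restrict_mem measurableSet_Ioi] with w hw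
      refine ((hgint w hw).const_mul (Real.exp (-w ^ 2))).mono'
        (by exact (hmeas.comp measurable_prodMk_right).aestronglyMeasurable) ?_
      filter_upwards with x
      exact (hnorm x w).le
    · have h2 := (integrableOn_rpow_mul_exp_neg_mul_sq (b := 1) one_pos
        (s := ((2 * k - 1 : ℕ) : ℝ)) (lt_of_lt_of_le (by norm_num) (Nat.cast_nonneg _)))
      have h2' : IntegrableOn _ (Ioi (0 : ℝ)) := h2.const_mul ((√(4 * Real.pi) / p) ^ (2 * k - 1))
      refine IntegrableOn.congr_fun h2' (fun w hw => ?_) measurableSet_Ioi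
      simp only [Function.uncurry_apply_pair, hnorm]
      rw [integral_const_mul, GaussianFourier.integral_rexp_neg_mul_sq_norm (hb w hw), hn]
      have h3 : (Real.pi / (p ^ 2 / (4 * w ^ 2))) ^ (((2 * k - 1 : ℕ) : ℝ) / 2) =
          (√(4 * Real.pi) / p * w) ^ (2 * k - 1) := by
        have hbw := hb w hw
        rw [Real.rpow_div_two_eq_sqrt _ (by positivity), hsq w hw, Real.rpow_natCast]
      rw [h3, mul_pow, Real.rpow_natCast]
      simp only [neg_mul, one_mul]
      ring
  have hswap := integral_integral_swap hint
  simp_rw [hx] at hswap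
  rw [integral_const_mul, setIntegral_congr_fun measurableSet_Ioi hw, integral_complex_ofReal,
    integral_const_mul, integral_pow_mul_exp_neg_mul_sq hk (by positivity)] at hswap
  have hsp : (√Real.pi : ℝ) ≠ 0 := by positivity
  have hmain : expNormFourier (p : ℂ) ξ = (((√Real.pi / 2)⁻¹ * ((√(4 * Real.pi) / p) ^ (2 * k - 1) *
      (Real.Gamma k / 2 / (1 + 4 * Real.pi ^ 2 * ‖ξ‖ ^ 2 / p ^ 2) ^ k)) : ℝ) : ℂ) := by
    rw [Complex.ofReal_mul, ← hswap, expNormFourier, ← mul_assoc, ← Complex.ofReal_mul,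
      inv_mul_cancel₀ (by positivity), Complex.ofReal_one, one_mul]
  rw [hmain]
  norm_cast
  have h5 : (1 + 4 * Real.pi ^ 2 * ‖ξ‖ ^ 2 / p ^ 2) ^ k =
      (p ^ 2 + 4 * Real.pi ^ 2 * ‖ξ‖ ^ 2) ^ k / (p ^ (2 * k - 1) * p) := by
    rw [← pow_succ, show 2 * k - 1 + 1 = 2 * k by omega, pow_mul, ← div_pow]
    congr 1
    field_simp
  rw [h5, div_pow]
  have h6 : 0 < p ^ 2 + 4 * Real.pi ^ 2 * ‖ξ‖ ^ 2 := by positivity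
  field_simp

/-- A zero would force p = ± i b, which is purely imaginary. Hence the Poisson kernel is holomorphic
on the right half-plane. -/
lemma sq_add_sq_ne_zero_of_re_pos {p : ℂ} (hp : 0 < p.re) (b : ℝ) : p ^ 2 + (b : ℂ) ^ 2 ≠ 0 := by
  intro h
  have h1 := congrArg Complex.im h
  have h2 := congrArg Complex.re h
  simp only [sq, Complex.add_im, Complex.mul_im, Complex.ofReal_im, Complex.ofReal_re,
    Complex.add_re, Complex.mul_re, Complex.zero_im, Complex.zero_re, mul_zero, zero_mul,
    add_zero, sub_zero] at h1 h2
  have h3 : p.im = 0 := by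
    have : p.re * p.im = 0 := by linarith
    rcases mul_eq_zero.1 this with h | h
    · exact absurd h hp.ne'
    · exact h
  rw [h3] at h2
  nlinarith

/-- The Fourier transform of `e^{-p ‖x‖}` in odd dimension is the Poisson kernel. -/
lemma expNormFourier_eq [Nontrivial E] {k : ℕ} (hk : 1 ≤ k)
    (hn : Module.finrank ℝ E = 2 * k - 1) {p : ℂ} (hp : 0 < p.re) (ξ : E) :
    expNormFourier p ξ = ((Real.Gamma k / √Real.pi * √(4 * Real.pi) ^ (2 * k - 1) : ℝ) : ℂ) *
      p / (p ^ 2 + 4 * Real.pi ^ 2 * ‖ξ‖ ^ 2) ^ k := by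
  have hopen : IsOpen {p : ℂ | 0 < p.re} := isOpen_lt continuous_const Complex.continuous_re
  have hne : ∀ q ∈ {p : ℂ | 0 < p.re}, q ^ 2 + 4 * (Real.pi : ℂ) ^ 2 * (‖ξ‖ : ℂ) ^ 2 ≠ 0 := by
    intro q hq
    have := sq_add_sq_ne_zero_of_re_pos hq (2 * Real.pi * ‖ξ‖)
    push_cast at this
    convert this using 2
    ring
  have h2 : DifferentiableOn ℂ (fun p : ℂ =>
      ((Real.Gamma k / √Real.pi * √(4 * Real.pi) ^ (2 * k - 1) : ℝ) : ℂ) *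
      p / (p ^ 2 + 4 * Real.pi ^ 2 * ‖ξ‖ ^ 2) ^ k) {p : ℂ | 0 < p.re} := by
    refine DifferentiableOn.fun_div (by fun_prop) (by fun_prop) fun q hq => ?_
    exact pow_ne_zero _ (hne q hq)
  have hconn : IsPreconnected {p : ℂ | 0 < p.re} :=
    (convex_halfSpace_re_gt 0).isPreconnected
  -- Identity theorem: both sides are holomorphic for Re p > 0 and agree at the real points 1 +
  -- 1/(n+1), which accumulate at 1.
  refine ((differentiableOn_expNormFourier ξ).analyticOnNhd hopen).eqOn_of_preconnected_of_frequently_eq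
    (h2.analyticOnNhd hopen) hconn (z₀ := 1) (by simp) ?_ hp
  have ht : Filter.Tendsto (fun n : ℕ => ((1 + 1 / ((n : ℝ) + 1) : ℝ) : ℂ)) Filter.atTop
      (nhdsWithin 1 {1}ᶜ) := by
    refine tendsto_nhdsWithin_iff.2 ⟨?_, Filter.Eventually.of_forall fun n => ?_⟩
    · have : Filter.Tendsto (fun n : ℕ => (1 + 1 / ((n : ℝ) + 1) : ℝ)) Filter.atTop
          (nhds (1 + 0)) := tendsto_const_nhds.add tendsto_one_div_add_atTop_nhds_zero_nat
      rw [add_zero] at this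
      exact (Complex.continuous_ofReal.tendsto 1).comp this
    · have h : (0 : ℝ) < 1 / ((n : ℝ) + 1) := by positivity
      simp only [mem_compl_iff, mem_singleton_iff]
      intro h'
      have : (1 + 1 / ((n : ℝ) + 1) : ℝ) = 1 := by exact_mod_cast h'
      linarith
  refine ht.frequently (Filter.Frequently.of_forall fun n => ?_)
  exact expNormFourier_ofReal hk hn (by positivity) ξ

end

/-! ### The conical Radon transform as a Fourier multiplier. -/

section

/-- Off the origin, a null set, x ↦ (x/‖x‖, ‖x‖) carries Lebesgue measure to the product of the
sphere measure and r^{dim E - 1} dr. -/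
lemma integral_polar {E F : Type*} [NormedAddCommGroup E] [InnerProductSpace ℝ E]
    [FiniteDimensional ℝ E] [MeasurableSpace E] [BorelSpace E] [Nontrivial E]
    [NormedAddCommGroup F] [NormedSpace ℝ F] {h : E → F} (hh : Integrable h) :
    ∫ x, h x = ∫ r in Ioi (0 : ℝ), ∫ θ : Metric.sphere (0 : E) 1,
      r ^ (Module.finrank ℝ E - 1) • h (r • (θ : E)) ∂(volume : Measure E).toSphere := by
  set d := Module.finrank ℝ E - 1
  have hmp := (volume : Measure E).measurePreserving_homeomorphUnitSphereProd
  have hemb := (homeomorphUnitSphereProd E).measurableEmbedding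
  have hcomp : ∀ x : ({0}ᶜ : Set E), (fun q : Metric.sphere (0 : E) 1 × Ioi (0 : ℝ) =>
      h ((q.2 : ℝ) • (q.1 : E))) (homeomorphUnitSphereProd E x) = h x := by
    intro x
    have hx : ‖(x : E)‖ ≠ 0 := norm_ne_zero_iff.2 x.2
    simp [smul_smul, mul_inv_cancel₀ hx]
  have hint : Integrable (fun q : Metric.sphere (0 : E) 1 × Ioi (0 : ℝ) =>
      h ((q.2 : ℝ) • (q.1 : E))) ((volume : Measure E).toSphere.prod (.volumeIoiPow d)) := by
    rw [← hmp.integrable_comp_emb hemb]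
    have : Integrable (fun x : ({0}ᶜ : Set E) => h x) ((volume : Measure E).comap (↑)) := by
      have h1 : IntegrableOn h ({0}ᶜ : Set E) := hh.integrableOn
      rwa [integrableOn_iff_comap_subtypeVal (measurableSet_singleton _).compl] at h1
    exact this.congr (Filter.Eventually.of_forall fun x => (hcomp x).symm)
  calc ∫ x, h x = ∫ x : ({0}ᶜ : Set E), h x ∂((volume : Measure E).comap (↑)) := by
        rw [integral_subtype_comap (measurableSet_singleton _).compl h,
          restrict_compl_singleton]
    _ = ∫ q : Metric.sphere (0 : E) 1 × Ioi (0 : ℝ), h ((q.2 : ℝ) • (q.1 : E))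
          ∂((volume : Measure E).toSphere.prod (.volumeIoiPow d)) := by
        rw [← hmp.integral_comp hemb]
        exact integral_congr_ae (Filter.Eventually.of_forall fun x => (hcomp x).symm)
    _ = ∫ r : Ioi (0 : ℝ), (∫ θ : Metric.sphere (0 : E) 1, h ((r : ℝ) • (θ : E))
          ∂(volume : Measure E).toSphere) ∂(.volumeIoiPow d) := integral_prod_symm _ hint
    _ = _ := by
        simp only [Measure.volumeIoiPow, ENNReal.ofReal]
        rw [integral_withDensity_eq_integral_smul,
          integral_subtype_comap measurableSet_Ioi fun r : ℝ => Real.toNNReal (r ^ d) •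
            ∫ θ : Metric.sphere (0 : E) 1, h (r • (θ : E)) ∂(volume : Measure E).toSphere]
        · refine setIntegral_congr_fun measurableSet_Ioi fun r hr => ?_
          rw [NNReal.smul_def, Real.coe_toNNReal _ (pow_nonneg (le_of_lt hr) _),
            integral_smul]
        · exact (measurable_subtype_coe.pow_const _).real_toNNReal

variable {𝕜 : Type*} [RCLike 𝕜] {n : ℕ}

lemma integrable_exp_smul_translate [NeZero n] {μ s c : ℝ} (hμ : 0 < μ) {f : Space n → 𝕜}
    (hf : Continuous f) {M : ℝ} (hM : ∀ p, ‖f p‖ ≤ M) (p : Space n) :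
    Integrable (fun x : EuclideanSpace ℝ (Fin n) =>
      (s ^ (n - 1) * Real.exp (-μ * ‖x‖)) • f (p.1 + s • x, p.2 + c * ‖x‖)) := by
  have h0 := (integrable_norm_pow_mul_exp_neg_mul_norm
    (E := EuclideanSpace ℝ (Fin n)) 0 hμ).const_mul (|s ^ (n - 1)| * M)
  refine h0.mono' (by exact (by fun_prop : Continuous _).aestronglyMeasurable) ?_
  filter_upwards with x
  rw [norm_smul, norm_mul, Real.norm_eq_abs, Real.norm_eq_abs, Real.abs_exp, pow_zero, one_mul]
  have := hM (p.1 + s • x, p.2 + c * ‖x‖)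
  calc _ ≤ |s ^ (n - 1)| * Real.exp (-μ * ‖x‖) * M := by gcongr
    _ = _ := by ring

/-- Polar coordinates read backwards: in (r sin ψ)^{n-1} the power of r is the Jacobian, and the
power of sin ψ remains as a constant. -/
lemma conicalRadon_eq_integral [NeZero n] {μ ψ : ℝ} (hμ : 0 < μ) {f : Space n → 𝕜}
    (hf : Continuous f) {M : ℝ} (hM : ∀ p, ‖f p‖ ≤ M) (p : Space n) :
    conicalRadon μ ψ f p = ∫ x : EuclideanSpace ℝ (Fin n),
      (Real.sin ψ ^ (n - 1) * Real.exp (-μ * ‖x‖)) •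
        f (p.1 + Real.sin ψ • x, p.2 + Real.cos ψ * ‖x‖) := by
  rw [integral_polar (integrable_exp_smul_translate hμ hf hM p), conicalRadon]
  refine setIntegral_congr_fun measurableSet_Ioi fun r hr => ?_
  have hr : 0 < r := hr
  simp only [finrank_euclideanSpace, Fintype.card_fin]
  refine integral_congr_ae (Filter.Eventually.of_forall fun θ => ?_)
  have hθ : ‖r • (θ : EuclideanSpace ℝ (Fin n))‖ = r := by
    rw [norm_smul, Real.norm_eq_abs, abs_of_pos hr, norm_eq_of_mem_sphere, mul_one]
  simp only [hθ]
  rw [smul_smul, smul_smul, mul_comm r (Real.sin ψ), mul_comm r (Real.cos ψ), mul_pow]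
  congr 1
  ring

lemma conicalRadon_clm_comp [NeZero n] {𝕜' : Type*} [RCLike 𝕜'] {μ ψ : ℝ} (hμ : 0 < μ)
    {f : Space n → 𝕜}
    (hf : Continuous f) {M : ℝ} (hM : ∀ p, ‖f p‖ ≤ M) (A : 𝕜 →L[ℝ] 𝕜') :
    conicalRadon μ ψ (fun p => A (f p)) = fun p => A (conicalRadon μ ψ f p) := by
  ext p
  rw [conicalRadon_eq_integral hμ hf hM,
    conicalRadon_eq_integral hμ (f := fun p => A (f p)) (A.continuous.comp hf) (M := ‖A‖ * M)
      (fun p => (A.le_opNorm _).trans (by gcongr; exact hM p)),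
    ← A.integral_comp_comm (integrable_exp_smul_translate hμ hf hM p)]
  simp only [map_smul]

/-- `ℝⁿ × ℝ` with its Euclidean norm. -/
abbrev EuclSpace (n : ℕ) : Type := WithLp 2 (EuclideanSpace ℝ (Fin n) × ℝ)

/-- The identity map from `ℝⁿ × ℝ` with its Euclidean norm to `ℝⁿ × ℝ` with the product norm. -/
noncomputable def toSpace (n : ℕ) : EuclSpace n ≃L[ℝ] Space n :=
  WithLp.prodContinuousLinearEquiv 2 ℝ (EuclideanSpace ℝ (Fin n)) ℝ

open FourierTransform SchwartzMap

/-- The Fourier multiplier on `𝓢(ℝⁿ × ℝ)` with symbol `m`. -/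
noncomputable def multiplier (m : EuclSpace n → ℂ) : 𝓢(Space n, ℂ) →L[ℂ] 𝓢(Space n, ℂ) :=
  compCLMOfContinuousLinearEquiv ℂ (toSpace n).symm ∘L fourierMultiplierCLM ℂ m ∘L
    compCLMOfContinuousLinearEquiv ℂ (toSpace n)

lemma multiplier_multiplier {m₁ m₂ : EuclSpace n → ℂ} (h₁ : m₁.HasTemperateGrowth)
    (h₂ : m₂.HasTemperateGrowth) (f : 𝓢(Space n, ℂ)) :
    multiplier m₁ (multiplier m₂ f) = multiplier (m₁ * m₂) f := by
  have h : ∀ g : 𝓢(EuclSpace n, ℂ), compCLMOfContinuousLinearEquiv ℂ (toSpace n)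
      (compCLMOfContinuousLinearEquiv ℂ (toSpace n).symm g) = g := fun g => by
    ext x; simp
  simp only [multiplier, ContinuousLinearMap.comp_apply, h,
    fourierMultiplierCLM_fourierMultiplierCLM_apply h₁ h₂]

lemma multiplier_const (c : ℂ) (f : 𝓢(Space n, ℂ)) : multiplier (fun _ => c) f = c • f := by
  ext x
  simp [multiplier]

lemma multiplier_apply {m : EuclSpace n → ℂ} (hm : m.HasTemperateGrowth) (f : 𝓢(Space n, ℂ))
    (p : Space n) : multiplier m f p = ∫ η : EuclSpace n,
      Complex.exp (2 * Real.pi * Complex.I * (inner ℝ η ((toSpace n).symm p) : ℝ)) *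
        (m η * 𝓕 (compCLMOfContinuousLinearEquiv ℂ (toSpace n) f) η) := by
  simp only [multiplier, ContinuousLinearMap.comp_apply, compCLMOfContinuousLinearEquiv_apply,
    Function.comp_apply, fourierMultiplierCLM_apply, fourierInv_coe, Real.fourierInv_eq',
    smul_eq_mul, smulLeftCLM_apply_apply hm]
  congr 1
  ext η
  congr 2
  push_cast
  ring

lemma multiplier_add {m₁ m₂ : EuclSpace n → ℂ} (h₁ : m₁.HasTemperateGrowth)
    (h₂ : m₂.HasTemperateGrowth) (f : 𝓢(Space n, ℂ)) :
    multiplier (m₁ + m₂) f = multiplier m₁ f + multiplier m₂ f := by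
  simp only [multiplier, ContinuousLinearMap.comp_apply, fourierMultiplierCLM_apply,
    smulLeftCLM_add h₁ h₂, _root_.add_apply, fourierInv_add, map_add]

lemma multiplier_lineDeriv (v : EuclSpace n) (f : 𝓢(Space n, ℂ)) :
    multiplier (fun η => 2 * Real.pi * Complex.I * (inner ℝ η v : ℝ)) f =
      LineDeriv.lineDerivOp (toSpace n v) f := by
  have h := lineDeriv_eq_fourierMultiplierCLM v (compCLMOfContinuousLinearEquiv ℂ (toSpace n) f)
  rw [lineDerivOp_compCLMOfContinuousLinearEquiv] at h
  have ht : (fun η : EuclSpace n => inner ℝ η v).HasTemperateGrowth := by fun_prop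
  have ht' : (fun η : EuclSpace n => ((inner ℝ η v : ℝ) : ℂ)).HasTemperateGrowth := by fun_prop
  rw [← fourierMultiplierCLM_ofReal ℂ ht] at h
  have h2 := fourierMultiplierCLM_smul (F := ℂ) ht' (2 * Real.pi * Complex.I)
  have h3 : (fun η => 2 * Real.pi * Complex.I * (inner ℝ η v : ℝ)) =
      (2 * Real.pi * Complex.I) • (fun η : EuclSpace n => ((inner ℝ η v : ℝ) : ℂ)) := by
    ext η; simp
  simp only [multiplier, ContinuousLinearMap.comp_apply]
  rw [h3, h2, _root_.smul_apply]
  have h4 := congrArg (compCLMOfContinuousLinearEquiv ℂ (toSpace n).symm) h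
  refine h4.symm.trans ?_
  ext x
  simp

/-- Fourier inversion is inserted for f and the integrals are exchanged; the x-integral of the
exponentials is then `expNormFourier`. Temperate growth of the symbol is a hypothesis because it is
visible only from the closed form. -/
lemma conicalRadon_eq_multiplier [NeZero n] {μ ψ : ℝ} (hμ : 0 < μ) {m : EuclSpace n → ℂ}
    (hm : m.HasTemperateGrowth)
    (hmeq : ∀ η, m η = Real.sin ψ ^ (n - 1) * expNormFourier
      (μ - 2 * Real.pi * Complex.I * (Real.cos ψ * η.snd : ℝ)) (Real.sin ψ • η.fst))
    (f : 𝓢(Space n, ℂ)) (p : Space n) : conicalRadon μ ψ f p = multiplier m f p := by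
  set F := 𝓕 (compCLMOfContinuousLinearEquiv ℂ (toSpace n) f) with hF
  have hinv : ∀ q : Space n, f q = ∫ η : EuclSpace n,
      Complex.exp (2 * Real.pi * Complex.I * (inner ℝ η ((toSpace n).symm q) : ℝ)) * F η := by
    intro q
    -- Fourier inversion is the case of the constant symbol 1.
    have h := multiplier_apply (m := fun _ => (1 : ℂ)) (by fun_prop) f q
    rw [multiplier_const, one_smul] at h
    rw [h]
    simp only [one_mul, hF]
  rw [conicalRadon_eq_integral hμ f.continuous (fun q => f.norm_le_seminorm ℝ q),
    multiplier_apply hm]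
  set s := Real.sin ψ
  set c := Real.cos ψ
  set G : EuclideanSpace ℝ (Fin n) → EuclSpace n → ℂ := fun x η =>
    (s ^ (n - 1) * Real.exp (-μ * ‖x‖) : ℝ) *
      (Complex.exp (2 * Real.pi * Complex.I *
        (inner ℝ η ((toSpace n).symm (p.1 + s • x, p.2 + c * ‖x‖)) : ℝ)) * F η) with hG
  have hcont : Continuous (Function.uncurry G) := by
    have := F.continuous
    simp only [hG, Function.uncurry_def]
    fun_prop
  have hint : Integrable (Function.uncurry G) (volume.prod volume) := by
    have h1 := ((integrable_norm_pow_mul_exp_neg_mul_norm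
      (E := EuclideanSpace ℝ (Fin n)) 0 hμ).const_mul (|s ^ (n - 1)|)).mul_prod
        (F.integrable (μ := volume)).norm
    refine h1.mono' hcont.aestronglyMeasurable (Filter.Eventually.of_forall fun q => ?_)
    simp only [hG, Function.uncurry_def, norm_mul, Complex.norm_real, Complex.norm_exp]
    simp
  have hxint : ∀ η, ∫ x, G x η =
      Complex.exp (2 * Real.pi * Complex.I * (inner ℝ η ((toSpace n).symm p) : ℝ)) *
        (m η * F η) := by
    intro η
    have : ∀ x, G x η = (Complex.exp (2 * Real.pi * Complex.I *
        (inner ℝ η ((toSpace n).symm p) : ℝ)) * (s ^ (n - 1) * F η)) *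
        Complex.exp (-(μ - 2 * Real.pi * Complex.I * (c * η.snd : ℝ)) * ‖x‖ +
          2 * Real.pi * Complex.I * (inner ℝ (s • η.fst) x : ℝ)) := by
      intro x
      have h1 : inner ℝ η ((toSpace n).symm (p.1 + s • x, p.2 + c * ‖x‖)) =
          inner ℝ η ((toSpace n).symm p) + (inner ℝ (s • η.fst) x + c * η.snd * ‖x‖) := by
        simp only [toSpace, WithLp.prodContinuousLinearEquiv_symm_apply, WithLp.prod_inner_apply,
          inner_add_right, inner_smul_right, inner_smul_left]
        simp
        ring
      rw [hG]
      simp only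
      rw [h1]
      push_cast
      have h2 : Complex.exp (2 * Real.pi * Complex.I *
          ((inner ℝ η ((toSpace n).symm p) : ℝ) +
            ((inner ℝ (s • η.fst) x : ℝ) + c * η.snd * ‖x‖))) * Complex.exp (-μ * ‖x‖) =
          Complex.exp (2 * Real.pi * Complex.I * (inner ℝ η ((toSpace n).symm p) : ℝ)) *
          Complex.exp (-(μ - 2 * Real.pi * Complex.I * (c * η.snd)) * ‖x‖ +
          2 * Real.pi * Complex.I * (inner ℝ (s • η.fst) x : ℝ)) := by
        rw [← Complex.exp_add, ← Complex.exp_add]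
        congr 1
        ring
      linear_combination (s ^ (n - 1) * F η) * h2
    simp_rw [this]
    rw [integral_const_mul, hmeq, expNormFourier]
    ring
  have hswap := integral_integral_swap hint
  simp_rw [hxint] at hswap
  rw [← hswap]
  congr 1
  ext x
  rw [hinv, hG, ← integral_smul]
  rfl

end

/-! ### The operator L on smooth functions and its formal adjoint. -/

section

open SchwartzMap LineDeriv

/-- The unit vector of the axis of the cones. -/
def axisDir (n : ℕ) : Space n := (0, 1)

/-- The unit vectors of the horizontal coordinates. -/
noncomputable def horizDir {n : ℕ} (i : Fin n) : Space n := (EuclideanSpace.basisFun (Fin n) ℝ i, 0)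

/-- The directional derivative. -/
noncomputable def dirDeriv {E F : Type*} [NormedAddCommGroup E] [NormedSpace ℝ E]
    [NormedAddCommGroup F] [NormedSpace ℝ F] (v : E) (g : E → F) : E → F :=
  fun p => fderiv ℝ g p v

section DirDeriv

variable {E F : Type*} [NormedAddCommGroup E] [NormedSpace ℝ E]
    [NormedAddCommGroup F] [NormedSpace ℝ F]

lemma contDiff_dirDeriv {g : E → F} (hg : ContDiff ℝ ∞ g) (v : E) :
    ContDiff ℝ ∞ (dirDeriv v g) :=
  (hg.fderiv_right (m := ∞) (by simp)).clm_apply contDiff_const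

lemma dirDeriv_clm_comp {G : Type*} [NormedAddCommGroup G] [NormedSpace ℝ G] {g : E → F}
    (hg : ContDiff ℝ ∞ g) (v : E) (A : F →L[ℝ] G) :
    dirDeriv v (fun p => A (g p)) = fun p => A (dirDeriv v g p) := by
  ext p
  have := (A.hasFDerivAt.comp p ((hg.differentiable (by simp)) p).hasFDerivAt).fderiv
  simp only [dirDeriv]
  rw [show (fun p => A (g p)) = A ∘ g from rfl, this]
  rfl

lemma dirDeriv_sub {g h : E → F} (hg : ContDiff ℝ ∞ g) (hh : ContDiff ℝ ∞ h) (v : E) :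
    dirDeriv v (fun p => g p - h p) = fun p => dirDeriv v g p - dirDeriv v h p := by
  ext p
  simp only [dirDeriv]
  rw [fderiv_fun_sub (hg.differentiable (by simp) p) (hh.differentiable (by simp) p)]
  rfl

lemma tsupport_dirDeriv_subset (g : E → F) (v : E) : tsupport (dirDeriv v g) ⊆ tsupport g :=
  tsupport_fderiv_apply_subset ℝ v

end DirDeriv

variable {𝕜 : Type*} [RCLike 𝕜] {n : ℕ}

lemma partialZ_eq_dirDeriv {g : Space n → 𝕜} (hg : ContDiff ℝ ∞ g) :
    partialZ g = dirDeriv (axisDir n) g := by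
  ext p
  have h1 : HasDerivAt (fun s : ℝ => (p.1, s)) ((0 : EuclideanSpace ℝ (Fin n)), (1 : ℝ)) p.2 :=
    (hasDerivAt_const _ _).prodMk (hasDerivAt_id _)
  exact ((hg.differentiable (by simp) p).hasFDerivAt.comp_hasDerivAt p.2 h1).deriv

lemma fderiv_section {g : Space n → 𝕜} (hg : ContDiff ℝ ∞ g) (z : ℝ)
    (y v : EuclideanSpace ℝ (Fin n)) :
    fderiv ℝ (fun y => g (y, z)) y v = dirDeriv (v, 0) g (y, z) := by
  have h1 : HasFDerivAt (fun y : EuclideanSpace ℝ (Fin n) => (y, z))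
      (ContinuousLinearMap.inl ℝ (EuclideanSpace ℝ (Fin n)) ℝ) y := by
    exact hasFDerivAt_prodMk_left y z
  have := ((hg.differentiable (by simp) (y, z)).hasFDerivAt.comp y h1).fderiv
  rw [show (fun y => g (y, z)) = g ∘ fun y => (y, z) from rfl, this]
  rfl

lemma laplacianX_eq_dirDeriv {g : Space n → 𝕜} (hg : ContDiff ℝ ∞ g) :
    laplacianX g = fun p => ∑ i, dirDeriv (horizDir i) (dirDeriv (horizDir i) g) p := by
  ext p
  rw [laplacianX, InnerProductSpace.laplacian_eq_iteratedFDeriv_orthonormalBasis _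
    (EuclideanSpace.basisFun (Fin n) ℝ)]
  refine Finset.sum_congr rfl fun i _ => ?_
  set v := EuclideanSpace.basisFun (Fin n) ℝ i with hv
  rw [iteratedFDeriv_two_apply]
  simp only [Matrix.cons_val_zero, Matrix.cons_val_one]
  have hs : ContDiff ℝ ∞ (fun y : EuclideanSpace ℝ (Fin n) => g (y, p.2)) :=
    hg.comp (contDiff_id.prodMk contDiff_const)
  have hd : DifferentiableAt ℝ (fderiv ℝ (fun y : EuclideanSpace ℝ (Fin n) => g (y, p.2))) p.1 :=
    (hs.fderiv_right (m := ∞) (by simp)).differentiable (by simp) _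
  have h1 : fderiv ℝ (fun y => fderiv ℝ (fun y : EuclideanSpace ℝ (Fin n) => g (y, p.2)) y v) p.1 v
      = fderiv ℝ (fderiv ℝ (fun y : EuclideanSpace ℝ (Fin n) => g (y, p.2))) p.1 v v := by
    rw [fderiv_clm_apply hd (differentiableAt_const _)]
    simp
  rw [← h1]
  simp_rw [fderiv_section hg]
  rw [fderiv_section (contDiff_dirDeriv hg _)]
  rfl

lemma opL_eq {μ ψ : ℝ} {g : Space n → 𝕜} (hg : ContDiff ℝ ∞ g) :
    opL μ ψ g = fun p => (μ / Real.cos ψ) ^ 2 • g p -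
      (2 * (μ / Real.cos ψ)) • dirDeriv (axisDir n) g p +
      dirDeriv (axisDir n) (dirDeriv (axisDir n) g) p -
      Real.tan ψ ^ 2 • ∑ i, dirDeriv (horizDir i) (dirDeriv (horizDir i) g) p := by
  ext p
  rw [opL, partialZ_eq_dirDeriv hg, partialZ_eq_dirDeriv (contDiff_dirDeriv hg _),
    laplacianX_eq_dirDeriv hg, div_pow, mul_div_assoc]

lemma contDiff_opL {μ ψ : ℝ} {g : Space n → 𝕜} (hg : ContDiff ℝ ∞ g) :
    ContDiff ℝ ∞ (opL μ ψ g) := by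
  rw [opL_eq hg]
  refine (((hg.const_smul _).sub ((contDiff_dirDeriv hg _).const_smul _)).add
    (contDiff_dirDeriv (contDiff_dirDeriv hg _) _)).sub (ContDiff.const_smul _ ?_)
  exact ContDiff.sum fun i _ => contDiff_dirDeriv (contDiff_dirDeriv hg _) _

lemma contDiff_opL_iterate {μ ψ : ℝ} {g : Space n → 𝕜} (hg : ContDiff ℝ ∞ g) (k : ℕ) :
    ContDiff ℝ ∞ ((opL μ ψ)^[k] g) := by
  induction k with
  | zero => exact hg
  | succ k ih => rw [Function.iterate_succ_apply']; exact contDiff_opL ih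

/-- L has real coefficients, so it commutes with real-linear maps of the values. This reduces the
case of general scalars to the complex one, where the Fourier transform is available. -/
lemma opL_clm_comp {𝕜' : Type*} [RCLike 𝕜'] {μ ψ : ℝ} {g : Space n → 𝕜} (hg : ContDiff ℝ ∞ g)
    (A : 𝕜 →L[ℝ] 𝕜') : opL μ ψ (fun p => A (g p)) = fun p => A (opL μ ψ g p) := by
  rw [opL_eq hg, opL_eq (g := fun p => A (g p)) (A.contDiff.comp hg)]
  simp only [dirDeriv_clm_comp hg, dirDeriv_clm_comp (contDiff_dirDeriv hg _), map_sub, map_add,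
    map_smul, map_sum]

lemma opL_iterate_clm_comp {𝕜' : Type*} [RCLike 𝕜'] {μ ψ : ℝ} {g : Space n → 𝕜}
    (hg : ContDiff ℝ ∞ g) (A : 𝕜 →L[ℝ] 𝕜') (k : ℕ) :
    (opL μ ψ)^[k] (fun p => A (g p)) = fun p => A ((opL μ ψ)^[k] g p) := by
  induction k with
  | zero => rfl
  | succ k ih =>
    simp only [Function.iterate_succ_apply']
    rw [ih, opL_clm_comp (contDiff_opL_iterate hg k)]

lemma opL_sub {μ ψ : ℝ} {g h : Space n → 𝕜} (hg : ContDiff ℝ ∞ g) (hh : ContDiff ℝ ∞ h) :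
    opL μ ψ (fun p => g p - h p) = fun p => opL μ ψ g p - opL μ ψ h p := by
  rw [opL_eq hg, opL_eq hh, opL_eq (hg.sub hh)]
  ext p
  simp only [dirDeriv_sub hg hh, dirDeriv_sub (contDiff_dirDeriv hg _) (contDiff_dirDeriv hh _),
    smul_sub, Finset.sum_sub_distrib]
  ring

lemma opL_iterate_sub {μ ψ : ℝ} {g h : Space n → 𝕜} (hg : ContDiff ℝ ∞ g) (hh : ContDiff ℝ ∞ h)
    (k : ℕ) : (opL μ ψ)^[k] (fun p => g p - h p) =
      fun p => (opL μ ψ)^[k] g p - (opL μ ψ)^[k] h p := by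
  induction k with
  | zero => rfl
  | succ k ih =>
    simp only [Function.iterate_succ_apply']
    rw [ih, opL_sub (contDiff_opL_iterate hg k) (contDiff_opL_iterate hh k)]

lemma hasCompactSupport_dirDeriv {E F : Type*} [NormedAddCommGroup E] [NormedSpace ℝ E]
    [NormedAddCommGroup F] [NormedSpace ℝ F] {g : E → F} (hg : HasCompactSupport g) (v : E) :
    HasCompactSupport (dirDeriv v g) :=
  hg.of_isClosed_subset (isClosed_tsupport _) (tsupport_dirDeriv_subset g v)

lemma hasCompactSupport_opL {μ ψ : ℝ} {g : Space n → 𝕜} (hg : ContDiff ℝ ∞ g)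
    (hc : HasCompactSupport g) : HasCompactSupport (opL μ ψ g) := by
  refine hc.mono' ?_
  rw [opL_eq hg, Function.support_subset_iff']
  intro p hp
  have h0 : ∀ (w : Space n → 𝕜), tsupport w ⊆ tsupport g → w p = 0 := fun w hw =>
    image_eq_zero_of_notMem_tsupport fun h => hp (hw h)
  have h1 := fun v : Space n => tsupport_dirDeriv_subset g v
  have h2 := fun v : Space n => (tsupport_dirDeriv_subset (dirDeriv v g) v).trans (h1 v)
  simp only [h0 _ subset_rfl, h0 _ (h1 _), h0 _ (h2 _), smul_zero, Finset.sum_const_zero]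
  simp

lemma integral_dirDeriv_mul {E : Type*} [NormedAddCommGroup E] [NormedSpace ℝ E]
    [FiniteDimensional ℝ E] [MeasurableSpace E] [BorelSpace E] {ν : Measure E}
    [ν.IsAddHaarMeasure] {φ w : E → 𝕜} (hφ : ContDiff ℝ ∞ φ) (hc : HasCompactSupport φ)
    (hw : ContDiff ℝ ∞ w) (v : E) :
    ∫ p, dirDeriv v φ p * w p ∂ν = -∫ p, φ p * dirDeriv v w p ∂ν := by
  have h := integral_mul_fderiv_eq_neg_fderiv_mul_of_integrable (μ := ν) (f := φ) (g := w)
    (v := v) ?_ ?_ ?_ (fun p _ => hφ.differentiable (by simp) p)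
    (fun p _ => hw.differentiable (by simp) p)
  · simp only [dirDeriv]
    rw [h, neg_neg]
  · exact ((contDiff_dirDeriv hφ v).continuous.mul hw.continuous).integrable_of_hasCompactSupport
      ((hasCompactSupport_dirDeriv hc v).mul_right)
  · exact (hφ.continuous.mul (contDiff_dirDeriv hw v).continuous).integrable_of_hasCompactSupport
      hc.mul_right
  · exact (hφ.continuous.mul hw.continuous).integrable_of_hasCompactSupport hc.mul_right

lemma integral_dirDeriv_dirDeriv_mul {E : Type*} [NormedAddCommGroup E] [NormedSpace ℝ E]
    [FiniteDimensional ℝ E] [MeasurableSpace E] [BorelSpace E] {ν : Measure E}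
    [ν.IsAddHaarMeasure] {φ w : E → 𝕜} (hφ : ContDiff ℝ ∞ φ) (hc : HasCompactSupport φ)
    (hw : ContDiff ℝ ∞ w) (v : E) :
    ∫ p, dirDeriv v (dirDeriv v φ) p * w p ∂ν = ∫ p, φ p * dirDeriv v (dirDeriv v w) p ∂ν := by
  rw [integral_dirDeriv_mul (contDiff_dirDeriv hφ v) (hasCompactSupport_dirDeriv hc v) hw,
    integral_dirDeriv_mul hφ hc (contDiff_dirDeriv hw v), neg_neg]

instance : (volume : Measure (Space n)).IsAddHaarMeasure :=
  inferInstanceAs (((volume : Measure (EuclideanSpace ℝ (Fin n))).prod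
    (volume : Measure ℝ)).IsAddHaarMeasure)

/-- The formal adjoint of `L` is obtained by changing the sign of `μ`. -/
lemma integral_opL_mul {μ ψ : ℝ} {φ w : Space n → 𝕜} (hφ : ContDiff ℝ ∞ φ)
    (hc : HasCompactSupport φ) (hw : ContDiff ℝ ∞ w) :
    ∫ p, opL (-μ) ψ φ p * w p = ∫ p, φ p * opL μ ψ w p := by
  have hL : ∀ {a : Space n → 𝕜}, ContDiff ℝ ∞ a → HasCompactSupport a →
      Integrable (fun p => a p * w p) := fun ha hac =>
    (ha.continuous.mul hw.continuous).integrable_of_hasCompactSupport hac.mul_right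
  have hR : ∀ {a : Space n → 𝕜}, ContDiff ℝ ∞ a → Integrable (fun p => φ p * a p) := fun ha =>
    (hφ.continuous.mul ha.continuous).integrable_of_hasCompactSupport hc.mul_right
  have hφ1 := contDiff_dirDeriv hφ
  have hφ2 := fun v => contDiff_dirDeriv (hφ1 v) v
  have hc1 := fun v => hasCompactSupport_dirDeriv hc v
  have hc2 := fun v => hasCompactSupport_dirDeriv (hc1 v) v
  have hw1 := contDiff_dirDeriv hw
  have hw2 := fun v => contDiff_dirDeriv (hw1 v) v
  rw [opL_eq hφ, opL_eq hw]
  simp only [sub_mul, add_mul, mul_sub, mul_add, smul_mul_assoc, mul_smul_comm, Finset.sum_mul,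
    Finset.mul_sum]
  have i1 := (hL hφ hc).fun_smul ((-μ / Real.cos ψ) ^ 2)
  have i2 := (hL (hφ1 (axisDir n)) (hc1 _)).fun_smul (2 * (-μ / Real.cos ψ))
  have i3 := hL (hφ2 (axisDir n)) (hc2 _)
  have i4 := (integrable_finsetSum Finset.univ fun i _ =>
    hL (hφ2 (horizDir (n := n) i)) (hc2 _)).fun_smul (Real.tan ψ ^ 2)
  have j1 := (hR hw).fun_smul ((μ / Real.cos ψ) ^ 2)
  have j2 := (hR (hw1 (axisDir n))).fun_smul (2 * (μ / Real.cos ψ))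
  have j3 := hR (hw2 (axisDir n))
  have j4 := (integrable_finsetSum Finset.univ fun i _ =>
    hR (hw2 (horizDir (n := n) i))).fun_smul (Real.tan ψ ^ 2)
  rw [integral_sub ((i1.sub' i2).fun_add i3) i4, integral_add (i1.sub' i2) i3, integral_sub i1 i2,
    integral_sub ((j1.sub' j2).fun_add j3) j4, integral_add (j1.sub' j2) j3, integral_sub j1 j2]
  rw [integral_smul, integral_smul, integral_smul, integral_smul, integral_smul, integral_smul,
    integral_finsetSum _ (fun i _ => hL (hφ2 (horizDir (n := n) i)) (hc2 _)),
    integral_finsetSum _ (fun i _ => hR (hw2 (horizDir (n := n) i)))]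
  simp only [integral_dirDeriv_dirDeriv_mul (ν := volume) hφ hc hw,
    integral_dirDeriv_mul (ν := volume) hφ hc hw]
  simp only [neg_div, neg_sq, mul_neg, neg_smul, smul_neg, neg_neg]

lemma hasCompactSupport_opL_iterate {μ ψ : ℝ} {g : Space n → 𝕜} (hg : ContDiff ℝ ∞ g)
    (hc : HasCompactSupport g) (k : ℕ) : HasCompactSupport ((opL μ ψ)^[k] g) := by
  induction k with
  | zero => exact hc
  | succ k ih =>
    rw [Function.iterate_succ_apply']
    exact hasCompactSupport_opL (contDiff_opL_iterate hg k) ih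

lemma integral_opL_iterate_mul {μ ψ : ℝ} {φ w : Space n → 𝕜} (hφ : ContDiff ℝ ∞ φ)
    (hc : HasCompactSupport φ) (hw : ContDiff ℝ ∞ w) (k : ℕ) :
    ∫ p, (opL (-μ) ψ)^[k] φ p * w p = ∫ p, φ p * (opL μ ψ)^[k] w p := by
  induction k generalizing w with
  | zero => rfl
  | succ k ih =>
    -- The outermost factor is removed from φ and becomes the innermost one on w; hence the
    -- induction generalises over w.
    rw [Function.iterate_succ_apply', Function.iterate_succ_apply,
      integral_opL_mul (contDiff_opL_iterate hφ k) (hasCompactSupport_opL_iterate hφ hc k) hw,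
      ih (contDiff_opL hw)]

end

/-! ### Density of compactly supported functions in the Schwartz space. -/

section

open SchwartzMap LineDeriv

section Density

variable {E F : Type*} [NormedAddCommGroup E] [NormedSpace ℝ E] [NormedAddCommGroup F]
  [NormedSpace ℝ F]

/-- All derivatives of `1 - χ (R⁻¹ x)` are `O((1 + ‖x‖) / R)` if `χ` is a cutoff function. -/
lemma norm_iteratedFDeriv_one_sub_dilation_le {χ : E → ℝ} (hχ : ContDiff ℝ ∞ χ)
    (hc : HasCompactSupport χ) (h1 : ∀ x, ‖x‖ ≤ 1 → χ x = 1) (i : ℕ) :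
    ∃ C, 0 ≤ C ∧ ∀ R : ℝ, 1 ≤ R → ∀ x, ‖iteratedFDeriv ℝ i (fun x => 1 - χ (R⁻¹ • x)) x‖ ≤
      C / R * (1 + ‖x‖) := by
  obtain ⟨C, hC⟩ := (hχ.continuous_iteratedFDeriv (m := i) (by exact_mod_cast le_top)
    |>.bounded_above_of_compact_support (hc.iteratedFDeriv i))
  refine ⟨1 + |C|, by positivity, fun R hR x => ?_⟩
  have hR0 : 0 < R := by linarith
  -- For i = 0 the function vanishes when ‖x‖ ≤ R and is bounded, while 1 ≤ ‖x‖ / R elsewhere. For i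
  -- > 0 the chain rule yields R^{-i} ≤ R^{-1}.
  rcases Nat.eq_zero_or_pos i with rfl | hi
  · rw [norm_iteratedFDeriv_zero, Real.norm_eq_abs]
    by_cases hx : ‖R⁻¹ • x‖ ≤ 1
    · rw [h1 _ hx, sub_self, abs_zero]
      positivity
    · rw [norm_smul, norm_inv, Real.norm_eq_abs, abs_of_pos hR0, not_le, inv_mul_eq_div,
        one_lt_div hR0] at hx
      have h2 : |1 - χ (R⁻¹ • x)| ≤ 1 + |C| := by
        have := hC (R⁻¹ • x)
        rw [norm_iteratedFDeriv_zero, Real.norm_eq_abs] at this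
        have h0 := this.trans (le_abs_self C)
        rw [abs_le] at h0 ⊢
        constructor <;> linarith [h0.1, h0.2]
      calc _ ≤ (1 + |C|) * 1 := by rwa [mul_one]
        _ ≤ (1 + |C|) * ((1 + ‖x‖) / R) := by
          gcongr
          rw [le_div_iff₀ hR0]
          linarith
        _ = _ := by ring
  · have h2 : iteratedFDeriv ℝ i (fun x => 1 - χ (R⁻¹ • x)) x =
        -iteratedFDeriv ℝ i (fun x => χ (R⁻¹ • x)) x := by
      have hs : ContDiff ℝ i (fun x => χ (R⁻¹ • x)) :=
        (hχ.comp (contDiff_const_smul _)).of_le (by exact_mod_cast le_top)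
      rw [show (fun x => 1 - χ (R⁻¹ • x)) = (fun _ => (1 : ℝ)) - (fun x => χ (R⁻¹ • x)) from rfl,
        iteratedFDeriv_sub_apply contDiff_const.contDiffAt hs.contDiffAt,
        iteratedFDeriv_const_of_ne hi.ne']
      simp
    rw [h2, norm_neg]
    have h3 : iteratedFDeriv ℝ i (fun x => χ (R⁻¹ • x)) x =
        R⁻¹ ^ i • iteratedFDeriv ℝ i χ (R⁻¹ • x) := by
      rw [iteratedFDeriv_comp_const_smul _ (hχ.of_le (by exact_mod_cast le_top))]
    rw [h3, norm_smul, norm_pow, norm_inv, Real.norm_eq_abs, abs_of_pos hR0]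
    have h4 : R⁻¹ ^ i ≤ R⁻¹ := by
      rw [← Nat.sub_add_cancel hi, pow_succ]
      exact mul_le_of_le_one_left (by positivity) (pow_le_one₀ (by positivity) (inv_le_one_of_one_le₀ hR))
    calc _ ≤ R⁻¹ * (1 + |C|) := by
          gcongr
          exact (hC _).trans ((le_abs_self C).trans (by linarith))
      _ = (1 + |C|) / R * 1 := by ring
      _ ≤ _ := by
        gcongr
        linarith [norm_nonneg x]

/-- Compactly supported functions are dense in the Schwartz space. -/
lemma exists_hasCompactSupport_tendsto [FiniteDimensional ℝ E] (φ : 𝓢(E, F)) :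
    ∃ u : ℕ → 𝓢(E, F), (∀ N, HasCompactSupport (u N)) ∧ Filter.Tendsto u Filter.atTop (nhds φ) := by
  let b : ContDiffBump (0 : E) := ⟨1, 2, one_pos, one_lt_two⟩
  set χ : E → ℝ := fun x => b x
  have hχ : ContDiff ℝ ∞ χ := b.contDiff
  have hc : HasCompactSupport χ := b.hasCompactSupport
  have h1 : ∀ x, ‖x‖ ≤ 1 → χ x = 1 := fun x hx => b.one_of_mem_closedBall (by simpa using hx)
  have hcR : ∀ R : ℝ, 1 ≤ R → HasCompactSupport (fun x => χ (R⁻¹ • x)) := fun R hR =>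
    hc.comp_homeomorph (Homeomorph.smulOfNeZero R⁻¹ (by positivity))
  have hχR : ∀ R : ℝ, ContDiff ℝ ∞ (fun x => χ (R⁻¹ • x)) := fun R =>
    hχ.comp (contDiff_const_smul _)
  have hR : ∀ N : ℕ, (1 : ℝ) ≤ N + 1 := fun N => by linarith [Nat.cast_nonneg (α := ℝ) N]
  have ht := fun N : ℕ => (hcR _ (hR N)).hasTemperateGrowth (hχR _)
  let u : ℕ → 𝓢(E, F) := fun N => smulLeftCLM F (fun x => χ (((N : ℝ) + 1)⁻¹ • x)) φ
  have hu : ∀ N x, u N x = χ (((N : ℝ) + 1)⁻¹ • x) • φ x := fun N x =>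
    smulLeftCLM_apply_apply (ht N) φ x
  refine ⟨u, fun N => ?_, ?_⟩
  · have : (u N : E → F) = fun x => χ (((N : ℝ) + 1)⁻¹ • x) • φ x := funext (hu N)
    rw [this]
    exact (hcR _ (hR N)).smul_right
  · rw [(schwartz_withSeminorms ℝ E F).tendsto_nhds u φ]
    rintro ⟨k, m⟩ ε hε
    choose C hC0 hC using fun i => norm_iteratedFDeriv_one_sub_dilation_le hχ hc h1 i
    set S : ℕ → ℕ → ℝ := fun k i => SchwartzMap.seminorm ℝ k i φ with hS
    have hSnn : ∀ k i, 0 ≤ S k i := fun k i => apply_nonneg _ _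
    -- The seminorms of weight k + 1 pay for the factor 1 + ‖x‖ in the cutoff estimate.
    set K := ∑ i ∈ Finset.range (m + 1), (m.choose i : ℝ) * (C i * (S k (m - i) + S (k + 1) (m - i)))
      with hK
    have hK0 : 0 ≤ K := Finset.sum_nonneg fun i _ => by
      have := hSnn k (m - i)
      have := hSnn (k + 1) (m - i)
      have := hC0 i
      positivity
    have hbound : ∀ N : ℕ, SchwartzMap.seminorm ℝ k m (u N - φ) ≤ K / ((N : ℝ) + 1) := by
      intro N
      refine seminorm_le_bound ℝ k m _ (by positivity) fun x => ?_
      have hfun : ((u N - φ : 𝓢(E, F)) : E → F) =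
          -(fun x => (1 - χ (((N : ℝ) + 1)⁻¹ • x)) • φ x) := by
        ext x
        simp [hu, sub_smul]
      rw [hfun, iteratedFDeriv_neg_apply, norm_neg]
      have hle := norm_iteratedFDeriv_smul_le (𝕜 := ℝ) (N := ∞)
        (contDiff_const.sub (hχR ((N : ℝ) + 1)) : ContDiff ℝ ∞ fun x => 1 - χ (((N : ℝ) + 1)⁻¹ • x))
        (φ.smooth ⊤) x (n := m) (by exact_mod_cast le_top)
      calc _ ≤ ‖x‖ ^ k * ∑ i ∈ Finset.range (m + 1), (m.choose i : ℝ) *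
              ‖iteratedFDeriv ℝ i (fun x => 1 - χ (((N : ℝ) + 1)⁻¹ • x)) x‖ *
              ‖iteratedFDeriv ℝ (m - i) φ x‖ := by gcongr
        _ ≤ ∑ i ∈ Finset.range (m + 1), (m.choose i : ℝ) *
              (C i * (S k (m - i) + S (k + 1) (m - i))) / ((N : ℝ) + 1) := by
            rw [Finset.mul_sum]
            refine Finset.sum_le_sum fun i _ => ?_
            have e1 := φ.le_seminorm ℝ k (m - i) x
            have e2 := φ.le_seminorm ℝ (k + 1) (m - i) x
            have e3 := hC i _ (hR N) x
            have e0 := hC0 i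
            calc _ ≤ ‖x‖ ^ k * ((m.choose i : ℝ) * (C i / ((N : ℝ) + 1) * (1 + ‖x‖)) *
                  ‖iteratedFDeriv ℝ (m - i) φ x‖) := by gcongr
              _ = (m.choose i : ℝ) * (C i / ((N : ℝ) + 1)) *
                  (‖x‖ ^ k * ‖iteratedFDeriv ℝ (m - i) φ x‖ +
                    ‖x‖ ^ (k + 1) * ‖iteratedFDeriv ℝ (m - i) φ x‖) := by ring
              _ ≤ (m.choose i : ℝ) * (C i / ((N : ℝ) + 1)) * (S k (m - i) + S (k + 1) (m - i)) := by
                  gcongr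
              _ = _ := by ring
        _ = _ := by rw [hK, Finset.sum_div]
    have hlim : Filter.Tendsto (fun N : ℕ => K / ((N : ℝ) + 1)) Filter.atTop (nhds 0) := by
      have := tendsto_one_div_add_atTop_nhds_zero_nat.const_mul K
      simpa [div_eq_mul_inv] using this
    filter_upwards [hlim.eventually (gt_mem_nhds hε)] with N hN
    exact (hbound N).trans_lt hN

lemma clm_eq_zero_of_hasCompactSupport [FiniteDimensional ℝ E] {𝕜 : Type*} [RCLike 𝕜]
    [NormedSpace 𝕜 F] [SMulCommClass ℝ 𝕜 F] {T : 𝓢(E, F) →L[𝕜] 𝕜}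
    (hT : ∀ φ : 𝓢(E, F), HasCompactSupport φ → T φ = 0) (φ : 𝓢(E, F)) : T φ = 0 := by
  obtain ⟨u, hu, hlim⟩ := exists_hasCompactSupport_tendsto φ
  refine tendsto_nhds_unique ((T.continuous.tendsto φ).comp hlim) ?_
  refine tendsto_const_nhds.congr fun N => ?_
  exact (hT (u N) (hu N)).symm

end Density

end

/-! ### The symbol of L, surjectivity on Schwartz functions, and uniqueness. -/

section

open SchwartzMap LineDeriv

variable {n : ℕ}

/-- The symbol `(α - 2πiζ)² + (2πτ)²‖ξ‖²`, which is that of `L` for `α = μ / cos ψ` and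
`τ = tan ψ`. -/
noncomputable def coneSymbol (α τ : ℝ) (η : EuclSpace n) : ℂ :=
  (α - 2 * Real.pi * Complex.I * (η.snd : ℝ)) ^ 2 +
    (2 * Real.pi * τ) ^ 2 * ((‖η.fst‖ ^ 2 : ℝ) : ℂ)

lemma hasTemperateGrowth_snd : (fun η : EuclSpace n => η.snd).HasTemperateGrowth :=
  ((ContinuousLinearMap.snd ℝ (EuclideanSpace ℝ (Fin n)) ℝ).comp
    (toSpace n : EuclSpace n →L[ℝ] Space n)).hasTemperateGrowth

lemma hasTemperateGrowth_norm_fst_sq :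
    (fun η : EuclSpace n => ‖η.fst‖ ^ 2).HasTemperateGrowth :=
  (Function.hasTemperateGrowth_norm_sq (H := EuclideanSpace ℝ (Fin n))).comp
    ((ContinuousLinearMap.fst ℝ (EuclideanSpace ℝ (Fin n)) ℝ).comp
    (toSpace n : EuclSpace n →L[ℝ] Space n)).hasTemperateGrowth

lemma hasTemperateGrowth_axisFactor (α : ℝ) : (fun η : EuclSpace n =>
    (α - 2 * Real.pi * Complex.I * (η.snd : ℝ) : ℂ)).HasTemperateGrowth := by
  have h1 := hasTemperateGrowth_snd (n := n)
  fun_prop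

lemma hasTemperateGrowth_coneSymbol (α τ : ℝ) :
    (coneSymbol (n := n) α τ).HasTemperateGrowth := by
  have h1 := hasTemperateGrowth_axisFactor (n := n) α
  have h2 := hasTemperateGrowth_norm_fst_sq (n := n)
  unfold coneSymbol
  fun_prop

/-- The modulus squared is α⁴ plus nonnegative terms. This excludes zeros when α ≠ 0 and controls
the inverse symbol. -/
lemma normSq_coneSymbol (α τ : ℝ) (η : EuclSpace n) : Complex.normSq (coneSymbol α τ η) =
    α ^ 4 + 2 * α ^ 2 * ((2 * Real.pi * η.snd) ^ 2 + (2 * Real.pi * τ) ^ 2 * ‖η.fst‖ ^ 2) +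
      ((2 * Real.pi * η.snd) ^ 2 - (2 * Real.pi * τ) ^ 2 * ‖η.fst‖ ^ 2) ^ 2 := by
  have h : coneSymbol α τ η = ((α ^ 2 - (2 * Real.pi * η.snd) ^ 2 +
      (2 * Real.pi * τ) ^ 2 * ‖η.fst‖ ^ 2 : ℝ) : ℂ) +
      ((-(2 * α * (2 * Real.pi * η.snd)) : ℝ) : ℂ) * Complex.I := by
    rw [coneSymbol]
    push_cast
    linear_combination (4 * (Real.pi : ℂ) ^ 2 * (η.snd : ℂ) ^ 2) * Complex.I_sq
  rw [h, Complex.normSq_add_mul_I]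
  ring

lemma coneSymbol_ne_zero {α : ℝ} (hα : α ≠ 0) (τ : ℝ) (η : EuclSpace n) :
    coneSymbol α τ η ≠ 0 := by
  intro h
  have h1 := normSq_coneSymbol α τ η
  rw [h, map_zero] at h1
  have h2 : 0 < α ^ 4 := by positivity
  have h3 : 0 ≤ 2 * α ^ 2 * ((2 * Real.pi * η.snd) ^ 2 + (2 * Real.pi * τ) ^ 2 * ‖η.fst‖ ^ 2) +
      ((2 * Real.pi * η.snd) ^ 2 - (2 * Real.pi * τ) ^ 2 * ‖η.fst‖ ^ 2) ^ 2 := by positivity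
  linarith

/-- The terms of `normSq_coneSymbol` are arranged as |σ|² = α⁴ (1 + ‖U‖²): the linear map A carries
the quadratic terms, and q the remaining square. Then 1/σ is the conjugate of σ times α⁻⁴ (1 +
‖U‖²)⁻¹, and U has temperate growth. -/
lemma hasTemperateGrowth_inv_coneSymbol {α : ℝ} (hα : α ≠ 0) (τ : ℝ) :
    (fun η : EuclSpace n => (coneSymbol α τ η)⁻¹).HasTemperateGrowth := by
  let A : EuclSpace n →L[ℝ] EuclSpace n := ((toSpace n).symm : Space n →L[ℝ] EuclSpace n).comp
    ((((√2 * (2 * Real.pi * τ) / α) • ContinuousLinearMap.fst ℝ (EuclideanSpace ℝ (Fin n)) ℝ).prod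
      ((√2 * (2 * Real.pi) / α) • ContinuousLinearMap.snd ℝ (EuclideanSpace ℝ (Fin n)) ℝ)).comp
      (toSpace n : EuclSpace n →L[ℝ] Space n))
  let e := (WithLp.prodContinuousLinearEquiv 2 ℝ (EuclSpace n) ℝ).symm
  let q : EuclSpace n → ℝ := fun η =>
    ((2 * Real.pi * η.snd) ^ 2 - (2 * Real.pi * τ) ^ 2 * ‖η.fst‖ ^ 2) / α ^ 2
  have hq : q.HasTemperateGrowth := by
    have h1 := hasTemperateGrowth_snd (n := n)
    have h2 := hasTemperateGrowth_norm_fst_sq (n := n)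
    simp only [q, div_eq_mul_inv]
    fun_prop
  let U : EuclSpace n → WithLp 2 (EuclSpace n × ℝ) := fun η =>
    (((e : _ →L[ℝ] WithLp 2 (EuclSpace n × ℝ)).comp
      (ContinuousLinearMap.inl ℝ (EuclSpace n) ℝ)).comp A) η +
      ((e : _ →L[ℝ] WithLp 2 (EuclSpace n × ℝ)).comp
      (ContinuousLinearMap.inr ℝ (EuclSpace n) ℝ)) (q η)
  have hU : U.HasTemperateGrowth :=
    (ContinuousLinearMap.hasTemperateGrowth _).add
      ((ContinuousLinearMap.hasTemperateGrowth _).comp hq)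
  have hUeq : ∀ η, U η = WithLp.toLp 2 (A η, q η) := by
    intro η
    simp only [U, e, ContinuousLinearMap.comp_apply, ContinuousLinearMap.inl_apply,
      ContinuousLinearMap.inr_apply, ← map_add]
    simp
  have hAeq : ∀ η, A η = WithLp.toLp 2 ((√2 * (2 * Real.pi * τ) / α) • η.fst,
      (√2 * (2 * Real.pi) / α) • η.snd) := fun η => rfl
  have hAnorm : ∀ η, ‖A η‖ ^ 2 = 2 * ((2 * Real.pi * τ) / α) ^ 2 * ‖η.fst‖ ^ 2 +
      2 * ((2 * Real.pi) / α) ^ 2 * η.snd ^ 2 := by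
    intro η
    rw [hAeq, WithLp.prod_norm_sq_eq_of_L2]
    change ‖(√2 * (2 * Real.pi * τ) / α) • η.fst‖ ^ 2 + ‖(√2 * (2 * Real.pi) / α) • η.snd‖ ^ 2 = _
    simp only [smul_eq_mul, norm_mul, norm_smul, Real.norm_eq_abs, mul_pow, sq_abs, div_pow]
    rw [Real.sq_sqrt zero_le_two]
    ring
  have hnorm : ∀ η, Complex.normSq (coneSymbol α τ η) = α ^ 4 * (1 + ‖U η‖ ^ 2) := by
    intro η
    have hU2 : ‖U η‖ ^ 2 = ‖A η‖ ^ 2 + q η ^ 2 := by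
      rw [hUeq, WithLp.prod_norm_sq_eq_of_L2]
      simp only [Real.norm_eq_abs, sq_abs]
      rfl
    rw [hU2, hAnorm, normSq_coneSymbol]
    simp only [q]
    field_simp
    ring
  have hinv := (Function.hasTemperateGrowth_one_add_norm_sq_rpow
    (WithLp 2 (EuclSpace n × ℝ)) (-1)).comp hU
  have hconj : (fun η : EuclSpace n =>
      (starRingEnd ℂ) (coneSymbol α τ η)).HasTemperateGrowth :=
    (Complex.conjCLE : ℂ →L[ℝ] ℂ).hasTemperateGrowth.comp (hasTemperateGrowth_coneSymbol α τ)
  have heq : (fun η : EuclSpace n => (coneSymbol α τ η)⁻¹) = fun η =>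
      (starRingEnd ℂ) (coneSymbol α τ η) * (((α ^ 4)⁻¹ * (1 + ‖U η‖ ^ 2) ^ (-1 : ℝ) : ℝ) : ℂ) := by
    ext η
    rw [Complex.inv_def, hnorm, mul_inv, Real.rpow_neg_one]
  rw [heq]
  have hinv' : (fun η => (1 + ‖U η‖ ^ 2) ^ (-1 : ℝ)).HasTemperateGrowth := hinv
  fun_prop

variable {𝕜 : Type*} [RCLike 𝕜]

/-- The operator `L` on the Schwartz space. -/
noncomputable def schwartzOpL (μ ψ : ℝ) : 𝓢(Space n, 𝕜) →L[𝕜] 𝓢(Space n, 𝕜) :=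
  (((μ / Real.cos ψ) ^ 2 : ℝ) : 𝕜) • ContinuousLinearMap.id 𝕜 𝓢(Space n, 𝕜) -
    ((2 * (μ / Real.cos ψ) : ℝ) : 𝕜) • lineDerivOpCLM 𝕜 𝓢(Space n, 𝕜) (axisDir n) +
    lineDerivOpCLM 𝕜 𝓢(Space n, 𝕜) (axisDir n) ∘L lineDerivOpCLM 𝕜 𝓢(Space n, 𝕜) (axisDir n) -
    ((Real.tan ψ ^ 2 : ℝ) : 𝕜) • ∑ i : Fin n, lineDerivOpCLM 𝕜 𝓢(Space n, 𝕜) (horizDir i) ∘L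
      lineDerivOpCLM 𝕜 𝓢(Space n, 𝕜) (horizDir i)

lemma schwartzOpL_apply (μ ψ : ℝ) (f : 𝓢(Space n, 𝕜)) :
    schwartzOpL μ ψ f = ((μ / Real.cos ψ) ^ 2) • f -
      (2 * (μ / Real.cos ψ)) • lineDerivOp (axisDir n) f +
      lineDerivOp (axisDir n) (lineDerivOp (axisDir n) f) -
      (Real.tan ψ ^ 2) • ∑ i : Fin n, lineDerivOp (horizDir i) (lineDerivOp (horizDir i) f) := by
  ext p
  simp [schwartzOpL, -map_mul, -map_pow, -map_div₀, RCLike.real_smul_eq_coe_mul]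

lemma coe_schwartzOpL (μ ψ : ℝ) (f : 𝓢(Space n, 𝕜)) :
    (schwartzOpL μ ψ f : Space n → 𝕜) = opL μ ψ f := by
  rw [opL_eq (f.smooth ⊤)]
  ext p
  rw [schwartzOpL_apply]
  simp only [_root_.sub_apply, _root_.add_apply, _root_.smul_apply, _root_.sum_apply]
  rfl

lemma coe_schwartzOpL_iterate (μ ψ : ℝ) (f : 𝓢(Space n, 𝕜)) (k : ℕ) :
    (((schwartzOpL μ ψ)^[k] f : 𝓢(Space n, 𝕜)) : Space n → 𝕜) = (opL μ ψ)^[k] f := by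
  induction k with
  | zero => rfl
  | succ k ih => rw [Function.iterate_succ_apply', Function.iterate_succ_apply',
      coe_schwartzOpL, ih]

lemma multiplier_sum {ι : Type*} (s : Finset ι) {g : ι → EuclSpace n → ℂ}
    (hg : ∀ i ∈ s, (g i).HasTemperateGrowth) (f : 𝓢(Space n, ℂ)) :
    multiplier (fun η => ∑ i ∈ s, g i η) f = ∑ i ∈ s, multiplier (g i) f := by
  simp only [multiplier, ContinuousLinearMap.comp_apply, fourierMultiplierCLM_sum ℂ hg,
    _root_.sum_apply, map_sum]

lemma schwartzOpL_eq_multiplier (μ ψ : ℝ) (f : 𝓢(Space n, ℂ)) :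
    schwartzOpL μ ψ f = multiplier (coneSymbol (μ / Real.cos ψ) (Real.tan ψ)) f := by
  set α := μ / Real.cos ψ with hα
  set τ := Real.tan ψ with hτ
  let m : Space n → EuclSpace n → ℂ := fun v η =>
    2 * Real.pi * Complex.I * (inner ℝ η ((toSpace n).symm v) : ℝ)
  have hm : ∀ v, (m v).HasTemperateGrowth := fun v => by
    simp only [m]
    fun_prop
  have hm1 : ∀ (v : Space n) (f : 𝓢(Space n, ℂ)), multiplier (m v) f = lineDerivOp v f := fun v f => by
    have := multiplier_lineDeriv ((toSpace n).symm v) f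
    rwa [ContinuousLinearEquiv.apply_symm_apply] at this
  have hm2 : ∀ (v : Space n) (f : 𝓢(Space n, ℂ)),
      multiplier (m v * m v) f = lineDerivOp v (lineDerivOp v f) := fun v f => by
    rw [← multiplier_multiplier (hm v) (hm v), hm1, hm1]
  have hc : ∀ (c : ℝ) {w : EuclSpace n → ℂ} (_ : w.HasTemperateGrowth) (f : 𝓢(Space n, ℂ)),
      multiplier ((fun _ => (c : ℂ)) * w) f = c • multiplier w f := fun c w hw f => by
    rw [← multiplier_multiplier (by fun_prop) hw, multiplier_const]
    ext x
    simp
  have hmm := fun v => (hm v).mul (hm v)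
  have hsum : (∑ i : Fin n, m (horizDir i) * m (horizDir i)).HasTemperateGrowth :=  by
    have := Function.HasTemperateGrowth.sum (s := Finset.univ) (fun i _ => hmm (horizDir (n := n) i))
    rwa [← Finset.sum_fn] at this
  have hsym : coneSymbol (n := n) α τ = ((fun _ => ((α ^ 2 : ℝ) : ℂ)) +
      (fun _ => ((-(2 * α) : ℝ) : ℂ)) * m (axisDir n)) +
      (m (axisDir n) * m (axisDir n) +
      (fun _ => ((-τ ^ 2 : ℝ) : ℂ)) * ∑ i : Fin n, m (horizDir i) * m (horizDir i)) := by
    ext η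
    have h1 : inner ℝ η ((toSpace n).symm (axisDir n)) = η.snd := by
      simp [toSpace, axisDir, WithLp.prod_inner_apply]
    have h2 : ∀ i, inner ℝ η ((toSpace n).symm (horizDir i)) = η.fst i := by
      intro i
      have h := (EuclideanSpace.basisFun (Fin n) ℝ).repr_apply_apply η.fst i
      rw [real_inner_comm, EuclideanSpace.basisFun_repr] at h
      simp only [toSpace, horizDir, WithLp.prodContinuousLinearEquiv_symm_apply,
        WithLp.prod_inner_apply, inner_zero_right, add_zero]
      exact h.symm
    simp only [coneSymbol, Pi.add_apply, Pi.mul_apply, Finset.sum_apply, m, h1, h2]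
    rw [EuclideanSpace.real_norm_sq_eq]
    have h3 : ∀ x : ℝ, (2 * Real.pi * Complex.I * (x : ℂ)) * (2 * Real.pi * Complex.I * (x : ℂ)) =
        -(2 * Real.pi) ^ 2 * (x : ℂ) ^ 2 := fun x => by
      linear_combination (4 * (Real.pi : ℂ) ^ 2 * (x : ℂ) ^ 2) * Complex.I_sq
    simp only [h3, ← Finset.mul_sum]
    push_cast
    linear_combination (4 * (Real.pi : ℂ) ^ 2 * (η.snd : ℂ) ^ 2) * Complex.I_sq
  have hmsum : multiplier (∑ i : Fin n, m (horizDir i) * m (horizDir i)) f =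
      ∑ i : Fin n, lineDerivOp (horizDir i) (lineDerivOp (horizDir i) f) := by
    have := multiplier_sum Finset.univ (fun i _ => hmm (horizDir (n := n) i)) f
    simp only [hm2] at this
    rw [← this]
    congr 2
    ext
    simp
  rw [hsym, multiplier_add (by fun_prop) (by fun_prop), multiplier_add (by fun_prop) (by fun_prop),
    multiplier_add (by fun_prop) (by fun_prop), hc _ (hm _), hc _ hsum, multiplier_const, hm1, hm2, hmsum]
  rw [schwartzOpL_apply]
  ext x
  simp [← hα, ← hτ]
  ring

/-- The preimage is obtained by applying the multiplier 1/σ over ℂ and mapping the values back to 𝕜.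
-/
lemma surjective_schwartzOpL {μ ψ : ℝ} (hμ : μ ≠ 0) (hψ : Real.cos ψ ≠ 0) :
    Function.Surjective (schwartzOpL μ ψ : 𝓢(Space n, 𝕜) →L[𝕜] 𝓢(Space n, 𝕜)) := by
  intro f
  have hα : μ / Real.cos ψ ≠ 0 := div_ne_zero hμ hψ
  let f' : 𝓢(Space n, ℂ) := postcompCLM (RCLike.map 𝕜 ℂ) f
  let φ : 𝓢(Space n, ℂ) := multiplier
    (fun η => (coneSymbol (μ / Real.cos ψ) (Real.tan ψ) η)⁻¹) f'
  have hφ : schwartzOpL μ ψ φ = f' := by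
    rw [schwartzOpL_eq_multiplier, multiplier_multiplier (hasTemperateGrowth_coneSymbol _ _)
      (hasTemperateGrowth_inv_coneSymbol hα _)]
    have : (coneSymbol (μ / Real.cos ψ) (Real.tan ψ) * fun η : EuclSpace n =>
        (coneSymbol (μ / Real.cos ψ) (Real.tan ψ) η)⁻¹) = fun _ => 1 := by
      ext η
      exact mul_inv_cancel₀ (coneSymbol_ne_zero hα _ η)
    rw [this, multiplier_const, one_smul]
  refine ⟨postcompCLM (RCLike.map ℂ 𝕜) φ, DFunLike.coe_injective ?_⟩
  rw [coe_schwartzOpL]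
  have h1 : ((postcompCLM (RCLike.map ℂ 𝕜) φ : 𝓢(Space n, 𝕜)) : Space n → 𝕜) =
    fun p => RCLike.map ℂ 𝕜 (φ p) := rfl
  rw [h1, opL_clm_comp (φ.smooth ⊤), ← coe_schwartzOpL, hφ]
  ext p
  simp [f']

/-- A tempered smooth solution of `L^k w = 0` vanishes. -/
lemma eq_zero_of_isTempered {μ ψ : ℝ} (hμ : μ ≠ 0) (hψ : Real.cos ψ ≠ 0) {w : Space n → 𝕜}
    (hw : ContDiff ℝ ∞ w) (ht : IsTempered w) (k : ℕ) (h0 : (opL μ ψ)^[k] w = 0) : w = 0 := by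
  obtain ⟨T, hT⟩ := ht
  have hker : ∀ φ : 𝓢(Space n, 𝕜), T ((schwartzOpL (-μ) ψ)^[k] φ) = 0 := by
    intro φ
    have := clm_eq_zero_of_hasCompactSupport (T := T ∘L (schwartzOpL (-μ) ψ) ^ k) (fun φ hφ => ?_) φ
    · simpa using this
    · have hcs : HasCompactSupport ((schwartzOpL (-μ) ψ)^[k] φ : 𝓢(Space n, 𝕜)) := by
        rw [coe_schwartzOpL_iterate]
        exact hasCompactSupport_opL_iterate (φ.smooth ⊤) hφ k
      have h1 : (T ∘L (schwartzOpL (-μ) ψ) ^ k) φ = T ((schwartzOpL (-μ) ψ)^[k] φ) := by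
        simp
      rw [h1, hT _ hcs, coe_schwartzOpL_iterate, integral_opL_iterate_mul (φ.smooth ⊤) hφ hw, h0]
      simp
  have hint : ∀ φ : 𝓢(Space n, 𝕜), HasCompactSupport φ → ∫ p, φ p * w p = 0 := by
    intro φ hφ
    -- The preimage χ need not have compact support, which is why `hker` is needed on the whole
    -- Schwartz space and rests on density.
    obtain ⟨χ, rfl⟩ := (surjective_schwartzOpL (n := n) (𝕜 := 𝕜) (neg_ne_zero.2 hμ) hψ).iterate k φ
    rw [← hT _ hφ, hker]
  have hae : ∀ᵐ p : Space n, w p = 0 := by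
    refine ae_eq_zero_of_integral_contDiff_smul_eq_zero hw.continuous.locallyIntegrable
      fun g hg hgc => ?_
    have hg' : ContDiff ℝ ∞ (fun p => ((g p : ℝ) : 𝕜)) := (RCLike.ofRealCLM (K := 𝕜)).contDiff.comp hg
    have hgc' : HasCompactSupport (fun p => ((g p : ℝ) : 𝕜)) :=
      hgc.comp_left (g := fun x : ℝ => (x : 𝕜)) (by simp)
    have := hint (hgc'.toSchwartzMap hg') hgc'
    simpa [RCLike.real_smul_eq_coe_mul] using this
  exact Measure.eq_of_ae_eq hae hw.continuous continuous_zero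

end

/-! ### The identity L^k C_μ f = c (α - ∂_z) f and the equation in z. -/

section

open SchwartzMap LineDeriv

variable {n : ℕ} {𝕜 : Type*} [RCLike 𝕜]

/-- The multiplier of the conical Radon transform inverts that of `L^k` up to a first order
factor. -/
lemma exists_schwartz_conicalRadon_complex [NeZero n] {μ ψ : ℝ} (hμ : 0 < μ)
    (hs : 0 < Real.sin ψ) (hc : 0 < Real.cos ψ) {k : ℕ} (hk : 1 ≤ k) (hn : n = 2 * k - 1) :
    ∃ c : ℝ, c ≠ 0 ∧ ∀ f : 𝓢(Space n, ℂ), ∃ Φ : 𝓢(Space n, ℂ),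
      (Φ : Space n → ℂ) = conicalRadon μ ψ f ∧ (opL μ ψ)^[k] Φ =
        fun p => c • ((μ / Real.cos ψ) • f p - dirDeriv (axisDir n) f p) := by
  set α := μ / Real.cos ψ with hα
  have hα0 : α ≠ 0 := by positivity
  set τ := Real.tan ψ with hτ
  set C : ℝ := Real.Gamma k / √Real.pi * √(4 * Real.pi) ^ (2 * k - 1) with hC
  have hk0 : (0 : ℝ) < k := by exact_mod_cast hk
  have hCpos : 0 < C := by
    have := Real.Gamma_pos_of_pos hk0
    positivity
  -- With p = cos ψ (α - 2πiζ), the Poisson kernel has numerator C cos ψ (α - 2πiζ) and denominator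
  -- (cos²ψ · σ)^k.
  set c : ℝ := Real.sin ψ ^ (n - 1) * C * Real.cos ψ / (Real.cos ψ ^ 2) ^ k with hcdef
  have hc0 : c ≠ 0 := by positivity
  have hcC : (Real.cos ψ : ℂ) ≠ 0 := by exact_mod_cast hc.ne'
  let l : EuclSpace n → ℂ := fun η => α - 2 * Real.pi * Complex.I * (η.snd : ℝ)
  let m : EuclSpace n → ℂ := fun η => c * l η * (coneSymbol α τ η)⁻¹ ^ k
  have hl : l.HasTemperateGrowth := hasTemperateGrowth_axisFactor α
  have hinv := hasTemperateGrowth_inv_coneSymbol (n := n) hα0 τ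
  have hm : m.HasTemperateGrowth := by
    have := hinv.pow k
    simp only [Pi.pow_def] at this
    fun_prop
  have hmeq : ∀ η, m η = Real.sin ψ ^ (n - 1) * expNormFourier
      (μ - 2 * Real.pi * Complex.I * (Real.cos ψ * η.snd : ℝ)) (Real.sin ψ • η.fst) := by
    intro η
    have hμα : (μ : ℂ) = Real.cos ψ * α := by
      rw [← Complex.ofReal_mul, hα, mul_div_cancel₀ _ hc.ne']
    have hp : (μ - 2 * Real.pi * Complex.I * (Real.cos ψ * η.snd : ℝ) : ℂ) =
        Real.cos ψ * l η := by
      simp only [l]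
      rw [hμα]
      push_cast
      ring
    have hre : 0 < (μ - 2 * Real.pi * Complex.I * (Real.cos ψ * η.snd : ℝ) : ℂ).re := by
      simpa using hμ
    have hsym : (Real.cos ψ * l η) ^ 2 + 4 * Real.pi ^ 2 * ((‖Real.sin ψ • η.fst‖ : ℝ) : ℂ) ^ 2 =
        Real.cos ψ ^ 2 * coneSymbol α τ η := by
      have hst : (Real.sin ψ : ℂ) = τ * Real.cos ψ := by
        rw [← Complex.ofReal_mul, hτ, Real.tan_mul_cos hc.ne']
      rw [norm_smul, Real.norm_eq_abs, abs_of_pos hs, coneSymbol]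
      push_cast
      rw [← Complex.ofReal_sin, hst]
      simp only [l, Complex.ofReal_cos]
      ring
    rw [expNormFourier_eq hk (by rw [finrank_euclideanSpace, Fintype.card_fin, hn]) hre, hp, hsym,
      ← hC]
    simp only [m, hcdef, mul_pow, inv_pow]
    have := coneSymbol_ne_zero hα0 τ η
    push_cast
    rw [← Complex.ofReal_cos]
    field_simp
  refine ⟨c, hc0, fun f => ⟨multiplier m f, ?_, ?_⟩⟩
  · ext p
    exact (conicalRadon_eq_multiplier hμ hm hmeq f p).symm
  have hiter : ∀ j : ℕ, ∀ u : 𝓢(Space n, ℂ), (schwartzOpL μ ψ)^[j] u =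
      multiplier (coneSymbol α τ ^ j) u := by
    intro j
    induction j with
    | zero =>
      intro u
      have := multiplier_const 1 u
      rw [one_smul] at this
      exact this.symm
    | succ j ih =>
      intro u
      rw [Function.iterate_succ_apply', ih, schwartzOpL_eq_multiplier,
        multiplier_multiplier (hasTemperateGrowth_coneSymbol _ _)
          ((hasTemperateGrowth_coneSymbol _ _).pow j), pow_succ']
  -- The powers of σ cancel, leaving the symbol of c (α - ∂_z).
  have hprod : coneSymbol α τ ^ k * m = (fun _ => ((c * α : ℝ) : ℂ)) + (fun _ => ((-c : ℝ) : ℂ)) *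
      fun η => 2 * Real.pi * Complex.I * (inner ℝ η ((toSpace n).symm (axisDir n)) : ℝ) := by
    ext η
    have h1 : inner ℝ η ((toSpace n).symm (axisDir n)) = η.snd := by
      simp [toSpace, axisDir, WithLp.prod_inner_apply]
    have := coneSymbol_ne_zero hα0 τ η
    simp only [Pi.mul_apply, Pi.pow_apply, Pi.add_apply, m, l, h1]
    rw [mul_left_comm, ← mul_pow, mul_inv_cancel₀ this]
    push_cast
    ring
  rw [← coe_schwartzOpL_iterate, hiter,
    multiplier_multiplier ((hasTemperateGrowth_coneSymbol _ _).pow k) hm, hprod,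
    multiplier_add (by fun_prop) (by fun_prop), multiplier_const,
    ← multiplier_multiplier (by fun_prop) (by fun_prop), multiplier_lineDeriv, multiplier_const,
    ContinuousLinearEquiv.apply_symm_apply]
  ext p
  simp only [_root_.add_apply, _root_.smul_apply, lineDerivOp_apply_eq_fderiv, dirDeriv,
    smul_eq_mul, Complex.real_smul]
  push_cast
  ring

lemma exists_schwartz_conicalRadon [NeZero n] {μ ψ : ℝ} (hμ : 0 < μ)
    (hs : 0 < Real.sin ψ) (hc : 0 < Real.cos ψ) {k : ℕ} (hk : 1 ≤ k) (hn : n = 2 * k - 1) :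
    ∃ c : ℝ, c ≠ 0 ∧ ∀ f : Space n → 𝕜, ContDiff ℝ ∞ f → HasCompactSupport f →
      ∃ Φ : 𝓢(Space n, 𝕜), (Φ : Space n → 𝕜) = conicalRadon μ ψ f ∧ (opL μ ψ)^[k] Φ =
        fun p => c • ((μ / Real.cos ψ) • f p - dirDeriv (axisDir n) f p) := by
  obtain ⟨c, hc0, h⟩ := exists_schwartz_conicalRadon_complex hμ hs hc hk hn
  refine ⟨c, hc0, fun f hf hfc => ?_⟩
  have hf' : ContDiff ℝ ∞ (fun p => RCLike.map 𝕜 ℂ (f p)) := (RCLike.map 𝕜 ℂ).contDiff.comp hf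
  have hfc' : HasCompactSupport (fun p => RCLike.map 𝕜 ℂ (f p)) :=
    hfc.comp_left (g := RCLike.map 𝕜 ℂ) (map_zero _)
  let f' : 𝓢(Space n, ℂ) := hfc'.toSchwartzMap hf'
  have hback : f = fun p => RCLike.map ℂ 𝕜 (f' p) := by
    ext p
    simp [f']
  obtain ⟨Φ, hΦ, hL⟩ := h f'
  refine ⟨postcompCLM (RCLike.map ℂ 𝕜) Φ, ?_, ?_⟩
  · rw [show conicalRadon μ ψ f = conicalRadon μ ψ fun p => RCLike.map ℂ 𝕜 (f' p) from
      congrArg _ hback, conicalRadon_clm_comp hμ f'.continuous (fun p => f'.norm_le_seminorm ℝ p), ← hΦ]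
    rfl
  · have h1 : ((postcompCLM (RCLike.map ℂ 𝕜) Φ : 𝓢(Space n, 𝕜)) : Space n → 𝕜) =
      fun p => RCLike.map ℂ 𝕜 (Φ p) := rfl
    rw [h1, opL_iterate_clm_comp (Φ.smooth ⊤), hL]
    conv_rhs => rw [hback]
    rw [dirDeriv_clm_comp (f'.smooth ⊤)]
    simp only [map_smul, map_sub]

lemma isTempered_schwartzMap (Φ : 𝓢(Space n, 𝕜)) : IsTempered (Φ : Space n → 𝕜) := by
  refine ⟨(integralCLM 𝕜 volume) ∘L smulLeftCLM 𝕜 (Φ : Space n → 𝕜), fun φ _ => ?_⟩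
  rw [ContinuousLinearMap.comp_apply, integralCLM_apply]
  simp only [smulLeftCLM_apply_apply Φ.hasTemperateGrowth, smul_eq_mul, mul_comm]

lemma IsTempered.sub {g h : Space n → 𝕜} (hg : IsTempered g) (hh : IsTempered h)
    (hgc : Continuous g) (hhc : Continuous h) : IsTempered (fun p => g p - h p) := by
  obtain ⟨S, hS⟩ := hg
  obtain ⟨T, hT⟩ := hh
  refine ⟨S - T, fun φ hφ => ?_⟩
  have hint : ∀ {u : Space n → 𝕜}, Continuous u → Integrable (fun p => φ p * u p) := fun hu =>
    (φ.continuous.mul hu).integrable_of_hasCompactSupport hφ.mul_right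
  rw [_root_.sub_apply, hS φ hφ, hT φ hφ, ← integral_sub (hint hgc) (hint hhc)]
  simp only [mul_sub]

lemma hasCompactSupport_slice {f : Space n → 𝕜} (hf : HasCompactSupport f)
    (x : EuclideanSpace ℝ (Fin n)) : HasCompactSupport (fun z : ℝ => f (x, z)) :=
  HasCompactSupport.intro (hf.isCompact.image continuous_snd) fun z hz =>
    image_eq_zero_of_notMem_tsupport fun h => hz ⟨(x, z), h, rfl⟩

lemma hasDerivAt_slice {f : Space n → 𝕜} (hf : ContDiff ℝ ∞ f) (x : EuclideanSpace ℝ (Fin n))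
    (z : ℝ) : HasDerivAt (fun z : ℝ => f (x, z)) (dirDeriv (axisDir n) f (x, z)) z := by
  have h1 : HasDerivAt (fun s : ℝ => (x, s)) ((0 : EuclideanSpace ℝ (Fin n)), (1 : ℝ)) z :=
    (hasDerivAt_const _ _).prodMk (hasDerivAt_id _)
  exact (hf.differentiable (by simp) (x, z)).hasFDerivAt.comp_hasDerivAt z h1

lemma hasDerivAt_exp_mul (α z : ℝ) :
    HasDerivAt (fun z : ℝ => Real.exp (α * z)) (α * Real.exp (α * z)) z := by
  have := ((hasDerivAt_id' z).const_mul α).exp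
  simpa [mul_comm] using this

/-- The integrand is the z-derivative of -c e^{-αz} f, which has compact support in z. -/
lemma integral_exp_smul_eq_zero {f : Space n → 𝕜} (hf : ContDiff ℝ ∞ f)
    (hfc : HasCompactSupport f) (α c : ℝ) (x : EuclideanSpace ℝ (Fin n)) :
    ∫ z : ℝ, Real.exp (-α * z) • c • (α • f (x, z) - dirDeriv (axisDir n) f (x, z)) = 0 := by
  have hcont : Continuous fun z : ℝ => f (x, z) := hf.continuous.comp (by fun_prop)
  have hcont' : Continuous fun z : ℝ => dirDeriv (axisDir n) f (x, z) :=
    (contDiff_dirDeriv hf _).continuous.comp (by fun_prop)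
  have hs := hasCompactSupport_slice hfc x
  have hs' := hasCompactSupport_slice (hasCompactSupport_dirDeriv hfc (axisDir n)) x
  have hsub : HasCompactSupport fun z : ℝ => α • f (x, z) - dirDeriv (axisDir n) f (x, z) :=
    (hs.smul_left (f := fun _ : ℝ => α)).sub hs'
  refine integral_eq_zero_of_hasDerivAt_of_integrable
    (f := fun z : ℝ => -(c • Real.exp (-α * z) • f (x, z))) (fun z => ?_) ?_ ?_
  · have h := ((hasDerivAt_exp_mul (-α) z).smul (hasDerivAt_slice hf x z)).const_smul c |>.neg
    refine h.congr_deriv ?_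
    module
  · refine Continuous.integrable_of_hasCompactSupport (by fun_prop) ?_
    exact (hsub.smul_left (f := fun _ : ℝ => c)).smul_left (f := fun z => Real.exp (-α * z))
  · refine Continuous.integrable_of_hasCompactSupport (by fun_prop) ?_
    exact ((hs.smul_left (f := fun z => Real.exp (-α * z))).smul_left (f := fun _ : ℝ => c)).neg

open Convolution in
/-- The compactly supported solution of `α f - ∂_z f = h`. -/
lemma exists_hasCompactSupport_solution {h : Space n → 𝕜} (hh : ContDiff ℝ ∞ h)
    (hhc : HasCompactSupport h) (α : ℝ)
    (h0 : ∀ x, ∫ z : ℝ, Real.exp (-α * z) • h (x, z) = 0) :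
    ∃ f : Space n → 𝕜, ContDiff ℝ ∞ f ∧ HasCompactSupport f ∧
      ∀ p, α • f p - dirDeriv (axisDir n) f p = h p := by
  have hslice : ∀ x, Continuous fun z : ℝ => h (x, z) := fun x =>
    hh.continuous.comp (by fun_prop)
  set H : EuclideanSpace ℝ (Fin n) → ℝ → 𝕜 := fun x s => Real.exp (-α * s) • h (x, s) with hH
  have hHc : ∀ x, Continuous (H x) := fun x => by
    have := hslice x
    fun_prop
  have hHi : ∀ x, Integrable (H x) := fun x => (hHc x).integrable_of_hasCompactSupport
    ((hasCompactSupport_slice hhc x).smul_left (f := fun z => Real.exp (-α * z)))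
  -- The integrating factor turns the equation into -∂_z (e^{-αz} f) = e^{-αz} h, integrated from
  -- -∞.
  set f : Space n → 𝕜 := fun p => -(Real.exp (α * p.2) • ∫ s in Iic p.2, H p.1 s) with hf
  have hsm : ContDiff ℝ ∞ f := by
    -- Joint smoothness in (x, z): f is minus the convolution in z of h(x, ·) with the locally
    -- integrable kernel 1_{t>0} e^{αt}, x being a parameter.
    set a : ℝ → ℝ := (Ioi 0).indicator fun t => Real.exp (α * t) with ha
    have hloc : LocallyIntegrable a := (Continuous.locallyIntegrable
      (by fun_prop : Continuous fun t : ℝ => Real.exp (α * t))).indicator measurableSet_Ioi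
    have hconv := contDiffOn_convolution_right_with_param (𝕜 := ℝ) (μ := volume) (n := ⊤)
      (ContinuousLinearMap.lsmul ℝ ℝ : ℝ →L[ℝ] 𝕜 →L[ℝ] 𝕜) (f := a)
      (g := fun (x : EuclideanSpace ℝ (Fin n)) (z : ℝ) => h (x, z)) (s := univ)
      (k := Prod.snd '' tsupport h) isOpen_univ (hhc.isCompact.image continuous_snd)
      (fun x z _ hz => image_eq_zero_of_notMem_tsupport fun h => hz ⟨(x, z), h, rfl⟩) hloc
      (by exact hh.contDiffOn)
    rw [univ_prod_univ, contDiffOn_univ] at hconv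
    have hval : f = fun p : Space n => -(a ⋆[ContinuousLinearMap.lsmul ℝ ℝ, volume]
        fun z => h (p.1, z)) p.2 := by
      ext p
      rw [convolution_def, ← integral_sub_left_eq_self _ volume p.2, hf]
      simp only
      rw [← integral_smul, integral_Iic_eq_integral_Iio, ← integral_indicator measurableSet_Iio]
      congr 2
      ext s
      by_cases hs : s < p.2
      · simp only [ha, hH, ContinuousLinearMap.lsmul_apply, sub_sub_cancel,
          indicator_of_mem (mem_Iio.2 hs), indicator_of_mem (mem_Ioi.2 (sub_pos.2 hs)),
          smul_smul, ← Real.exp_add]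
        congr 2
        ring
      · have hs' : p.2 - s ∉ Ioi (0 : ℝ) := by simpa using hs
        simp only [ha, ContinuousLinearMap.lsmul_apply, indicator_of_notMem hs',
          indicator_of_notMem (show s ∉ Iio p.2 from hs), zero_smul]
    rw [hval]
    exact hconv.neg
  have hderiv : ∀ x z, HasDerivAt (fun z => f (x, z)) (α • f (x, z) - h (x, z)) z := by
    intro x z
    have hJ : HasDerivAt (fun z => ∫ s in Iic z, H x s) (H x z) z := by
      have h1 : (fun z => ∫ s in Iic z, H x s) =
          fun z => (∫ s in Iic (0 : ℝ), H x s) + ∫ s in (0 : ℝ)..z, H x s := by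
        ext z
        rw [← intervalIntegral.integral_Iic_sub_Iic (hHi x).integrableOn (hHi x).integrableOn]
        abel
      rw [h1]
      exact ((hHc x).integral_hasStrictDerivAt 0 z).hasDerivAt.const_add _
    have h2 := ((hasDerivAt_exp_mul α z).smul hJ).neg
    refine h2.congr_deriv ?_
    simp only [hf, hH, smul_smul, ← Real.exp_add]
    rw [show α * z + -α * z = 0 by ring, Real.exp_zero]
    module
  refine ⟨f, hsm, ?_, fun p => ?_⟩
  · obtain ⟨R, hR⟩ := hhc.isCompact.isBounded.subset_closedBall (0 : Space n)
    refine HasCompactSupport.intro (isCompact_closedBall (0 : Space n) R) fun p hp => ?_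
    have hzero : ∀ q : Space n, R < ‖q‖ → h q = 0 := fun q hq =>
      image_eq_zero_of_notMem_tsupport fun h => by
        have := hR h
        rw [mem_closedBall_zero_iff] at this
        linarith
    rw [mem_closedBall_zero_iff, not_le, Prod.norm_def, lt_max_iff] at hp
    have hH0 : ∀ x s, R < ‖x‖ ∨ R < |s| → H x s = 0 := fun x s hxs => by
      simp only [hH]
      rw [hzero (x, s) (by rw [Prod.norm_def]; exact lt_max_iff.2 hxs), smul_zero]
    -- For large ‖x‖ or very negative z the integrand vanishes. For large positive z the integral is
    -- the full one, zero by `h0`.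
    have hI : ∫ s in Iic p.2, H p.1 s = 0 := by
      rcases hp with hp | hp
      · simp [hH0 p.1 _ (Or.inl hp)]
      · rcases lt_abs.1 hp with hp | hp
        · rw [setIntegral_eq_integral_of_forall_compl_eq_zero, h0]
          intro s hs
          rw [mem_Iic, not_le] at hs
          exact hH0 _ _ (Or.inr (lt_of_lt_of_le (hp.trans hs) (le_abs_self s)))
        · refine setIntegral_eq_zero_of_forall_eq_zero fun s hs => hH0 _ _ (Or.inr ?_)
          have hs : s ≤ p.2 := hs
          exact lt_of_lt_of_le (by linarith) (neg_le_abs s)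
    simp [hf, hI]
  · have := (hderiv p.1 p.2).unique (hasDerivAt_slice hsm p.1 p.2)
    rw [Prod.mk.eta] at this
    rw [← this]
    abel

end

end AttenuatedCone

theorem theorem1 {𝕜 : Type*} [RCLike 𝕜] (μ ψ : ℝ) (hμ : 0 < μ)
    (hψ : ψ ∈ Set.Ioo 0 (Real.pi / 2)) (n k : ℕ) (hk : 1 ≤ k) (hn : n = 2 * k - 1)
    (g : EuclideanSpace ℝ (Fin n) × ℝ → 𝕜) (hg : ContDiff ℝ ∞ g) :
    (∃ f : EuclideanSpace ℝ (Fin n) × ℝ → 𝕜,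
        ContDiff ℝ ∞ f ∧ HasCompactSupport f ∧ AttenuatedCone.conicalRadon μ ψ f = g) ↔
      (AttenuatedCone.IsTempered g ∧
        HasCompactSupport ((AttenuatedCone.opL μ ψ)^[k] g) ∧
        ∀ x : EuclideanSpace ℝ (Fin n),
          (∫ z : ℝ, Real.exp (-(μ / Real.cos ψ) * z) • ((AttenuatedCone.opL μ ψ)^[k] g) (x, z))
            = 0) := by
  have hs : 0 < Real.sin ψ := Real.sin_pos_of_pos_of_lt_pi hψ.1 (by linarith [hψ.2, Real.pi_pos])
  have hc : 0 < Real.cos ψ := Real.cos_pos_of_mem_Ioo ⟨by linarith [hψ.1, Real.pi_pos], hψ.2⟩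
  have : NeZero n := ⟨by omega⟩
  obtain ⟨c, hc0, hrange⟩ := AttenuatedCone.exists_schwartz_conicalRadon (𝕜 := 𝕜) hμ hs hc hk hn
  constructor
  · rintro ⟨f, hf, hfc, rfl⟩
    obtain ⟨Φ, hΦ, hL⟩ := hrange f hf hfc
    rw [← hΦ]
    refine ⟨AttenuatedCone.isTempered_schwartzMap Φ, ?_, fun x => ?_⟩
    · rw [hL]
      exact ((hfc.smul_left (f := fun _ => μ / Real.cos ψ)).sub
        (AttenuatedCone.hasCompactSupport_dirDeriv hfc _)).smul_left (f := fun _ => c)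
    · rw [hL]
      exact AttenuatedCone.integral_exp_smul_eq_zero hf hfc _ c x
  · rintro ⟨ht, hsupp, hint⟩
    have hh := AttenuatedCone.contDiff_opL_iterate (μ := μ) (ψ := ψ) hg k
    -- Dividing by c makes `hrange` return exactly L^k g for this f.
    obtain ⟨f, hf, hfc, hsol⟩ := AttenuatedCone.exists_hasCompactSupport_solution
      (h := fun p => c⁻¹ • (AttenuatedCone.opL μ ψ)^[k] g p) (hh.const_smul c⁻¹)
      (hsupp.smul_left (f := fun _ => c⁻¹)) (μ / Real.cos ψ) (fun x => by
        simp only [smul_comm _ c⁻¹, integral_smul, hint x, smul_zero])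
    obtain ⟨Φ, hΦ, hL⟩ := hrange f hf hfc
    refine ⟨f, hf, hfc, ?_⟩
    rw [← hΦ]
    have hzero := AttenuatedCone.eq_zero_of_isTempered hμ.ne' hc.ne' (hg.sub (Φ.smooth ⊤))
      (AttenuatedCone.IsTempered.sub ht (AttenuatedCone.isTempered_schwartzMap Φ) hg.continuous Φ.continuous) k (by
        rw [AttenuatedCone.opL_iterate_sub hg (Φ.smooth ⊤), hL]
        ext p
        simp only [hsol, smul_inv_smul₀ hc0, sub_self, Pi.zero_apply])
    ext p
    exact (sub_eq_zero.1 (congrFun hzero p)).symm
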